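/- Theorem 3. Let $G=K_{n+1}$ be a finite complete graph with a distinguished vertex $x'$ (the special vertex). A special colouring $\Delta'$ of $G$ is a colouring of the edges of $G$ together with a colour $\Delta'(x')$ of the vertex $x'$; it is a special $m$-colouring if exactly $m$ colours are used in total, the colour of $x'$ included. For $S\subseteq V(G)$ with $x'\in S$ let $\gamma(S)$ be the number of distinct colours in the set consisting of $\Delta'(x')$ and the colours of the edges with both endpoints in $S$, and let $$\mathcal{G}'_{\Delta'}(G)=\{\gamma(S): S\subseteq V(G),\ x'\in S\}.$$ For a vertex $v\neq x'$ let $\rho(v)$ be the number of colours, other than $\Delta'(x')$, that occur on some edge of $G$ and only on edges incident with $v$. Call $\Delta'$ bad if it is of one of the following two types: (i) all edges of $G$ have pairwise distinct colours, and none of them has the colour $\Delta'(x')$; (ii) all edges of $G\setminus\{x'\}$ have pairwise distinct colours, none of them has the colour $\Delta'(x')$, and there is at most one colour $c\ne\Delta'(x')$ that occurs on edges incident with $x'$; if there is such a $c$, it occurs on no edge of $G\setminus\{x'\}$. There is an absolute constant $\alpha'>0$ such that for every $m\ge 3$, every finite complete graph $G=K_{n+1}$ with a special vertex $x'$, and every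 special $m$-colouring $\Delta'$ of $G$ with $\rho(v)\ge 1$ for all $v\in V(G)\setminus\{x'\}$, at least one of the following holds: - $\Delta'$ is bad; - $|\mathcal{G}'_{\Delta'}(G)|\ge (1+\alpha')\sqrt{2m}$. -/

import Mathlib

/-- A special colouring of the complete graph on `V`: a distinguished (special) vertex, a colour
for every edge of the complete graph, and a colour for the special vertex. -/
structure SpecialColouring (V C : Type*) where
  /-- the special vertex -/
  special : V
  /-- the colours of the edges of the complete graph on `V` -/
  edge : SimpleGraph.TopEdgeLabeling V C
  /-- the colour of the special vertex -/
  specialColour : C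

namespace SpecialColouring

variable {V C : Type*} (Δ : SpecialColouring V C)

/-- The edges of the complete graph on `V` with both endpoints in `S`. -/
def edgesIn (S : Set V) : Set (⊤ : SimpleGraph V).edgeSet :=
  {e | ∀ v ∈ (e : Sym2 V), v ∈ S}

/-- The colours of the edges with both endpoints in `S`. -/
def edgeColours (S : Set V) : Set C :=
  Δ.edge '' edgesIn S

/-- The number of colours spanned by `S`: the colours of the edges inside `S` together with the
colour of the special vertex. It is meant for sets `S` that contain the special vertex. -/
noncomputable def gamma (S : Set V) : ℕ :=
  (insert Δ.specialColour (Δ.edgeColours S)).ncard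

/-- The colouring uses exactly `m` colours, counting the colour of the special vertex. -/
def IsColouringWith (m : ℕ) : Prop :=
  Δ.gamma Set.univ = m

/-- The set of all values `gamma S` over the vertex sets `S` that contain the special vertex. -/
def colourCounts : Set ℕ :=
  {k | ∃ S : Set V, Δ.special ∈ S ∧ Δ.gamma S = k}

/-- The number of colours that occur only on edges incident with `v`. The colour of the special
vertex is never counted. It is meant for vertices `v` other than the special one. -/
noncomputable def rho (v : V) : ℕ :=
  {c : C | c ∈ Δ.edgeColours Set.univ ∧ c ≠ Δ.specialColour ∧
    ∀ e : (⊤ : SimpleGraph V).edgeSet, Δ.edge e = c → v ∈ (e : Sym2 V)}.ncard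

/-- The edges with both endpoints in `S` have pairwise distinct colours. -/
def RainbowOn (S : Set V) : Prop :=
  Set.InjOn Δ.edge (edgesIn S)

/-- Type (i): the whole complete graph is rainbow, and no edge has the colour of the special
vertex. -/
def IsBadI : Prop :=
  Δ.RainbowOn Set.univ ∧ Δ.specialColour ∉ Δ.edgeColours Set.univ

/-- Type (ii): without the special vertex the complete graph is rainbow and avoids the colour of
the special vertex; every edge at the special vertex has that colour or one further colour `c`,
and `c` does not occur on the edges that avoid the special vertex. The choice
`c = Δ.specialColour` is the case in which no further colour is used. -/
def IsBadII : Prop :=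
  Δ.RainbowOn {Δ.special}ᶜ ∧ Δ.specialColour ∉ Δ.edgeColours {Δ.special}ᶜ ∧
    ∃ c : C, c ∉ Δ.edgeColours {Δ.special}ᶜ ∧
      ∀ e : (⊤ : SimpleGraph V).edgeSet, Δ.special ∈ (e : Sym2 V) →
        Δ.edge e = Δ.specialColour ∨ Δ.edge e = c

/-- A bad special colouring. -/
def IsBad : Prop :=
  Δ.IsBadI ∨ Δ.IsBadII

end SpecialColouring

/-!
The vertices other than the special one carry a colouring of the complete graph with loops: the loop
at `v` stands for the edge from `v` to the special vertex, and the colour of the special vertex is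
never counted. Write `f S` for the number of colours counted in `S`, `n` for the number of vertices,
`f` for the total number of colours and `N` for the number of values of `f S`. The hypothesis on
`rho` says that every vertex has a private colour (`Reduced`), so removing it lowers `f`.

A colour is private to at most two vertices, so some vertex has at most `2 f / n` private colours.
Removing such vertices one after the other gives `2 f + N ≤ N²` (`two_mul_count_add_le_sq`), which
beats `2 (f + 1) ≤ N²` by one as soon as `N ≥ 3`, and settles the colourings with a bounded number of
colours. It remains to gain a constant factor when `f` is large.

If `n ≥ (1 + δ) √(2 f)`, then each of the first steps of this descent costs so few colours that a
factor is gained (`Reduced.le_numValues_of_card_ge`).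

Otherwise the colouring is almost rainbow: only a small proportion of the `n (n + 1) / 2` edges and
loops is superfluous for displaying the colours. A colouring that is not bad has at most eight
vertices that witness this; they are never removed. Remove three further vertices with many private
colours. If two vertices have different numbers of private colours, or two pairs cost different
numbers of colours, then some set that is not in the chain supplies a fourth value
(`Reduced.exists_gain`). If there is no such deviation, then every edge has a colour of its own
(`NearRainbow.notMem_clashes_of_const`), every colour of a loop occurs on several loops, and two
colours occur on loops because the colouring is not bad; then the values come in consecutive
pairs for half of the sizes (`ProperEdges.le_numValues`). Repeating this until a quarter of the
vertices is gone gives `N ≥ 21 (n + 1) / 20` (`Reduced.le_numValues_of_near`).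
-/

set_option linter.unusedSectionVars false

/-! ### Looped colourings and private colours -/

/-- A colouring of the complete graph with loops on `W`, with a distinguished colour `blank` that
is never counted. The loop at `v` encodes the edge from `v` to an extra (special) vertex. -/
structure LoopedColouring (W C : Type*) where
  /-- the colour of an edge or loop -/
  colour : Sym2 W → C
  /-- the colour that is never counted -/
  blank : C

namespace LoopedColouring

variable {W C : Type*} [DecidableEq W] [DecidableEq C] (L : LoopedColouring W C)

/-- The colours, other than `blank`, of the edges and loops inside `S`. -/
def palette (S : Finset W) : Finset C :=
  (S.sym2.image L.colour).erase L.blank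

/-- The number of colours, other than `blank`, inside `S`. -/
def count (S : Finset W) : ℕ :=
  (L.palette S).card

/-- The private colours of `v` in `S`: those that disappear when `v` is removed from `S`. -/
def priv (S : Finset W) (v : W) : Finset C :=
  L.palette S \ L.palette (S.erase v)

/-- Every vertex of `S` has a private colour in `S`. -/
def Reduced (S : Finset W) : Prop :=
  ∀ v ∈ S, (L.priv S v).Nonempty

variable {L}

lemma mem_palette {S : Finset W} {c : C} :
    c ∈ L.palette S ↔ c ≠ L.blank ∧ ∃ e ∈ S.sym2, L.colour e = c := by
  simp [palette]

lemma palette_mono {S T : Finset W} (h : S ⊆ T) : L.palette S ⊆ L.palette T :=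
  Finset.erase_subset_erase _ (Finset.image_subset_image (Finset.sym2_mono h))

lemma count_mono {S T : Finset W} (h : S ⊆ T) : L.count S ≤ L.count T :=
  Finset.card_le_card (palette_mono h)

lemma mem_sym2_erase {S : Finset W} {v : W} {e : Sym2 W} :
    e ∈ (S.erase v).sym2 ↔ e ∈ S.sym2 ∧ v ∉ e := by
  simp only [Finset.mem_sym2_iff, Finset.mem_erase]
  constructor
  · intro h
    exact ⟨fun a ha => (h a ha).2, fun hv => (h v hv).1 rfl⟩
  · rintro ⟨h, hv⟩ a ha
    exact ⟨fun hav => hv (hav ▸ ha), h a ha⟩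

lemma mem_priv {S : Finset W} {v : W} {c : C} :
    c ∈ L.priv S v ↔ c ∈ L.palette S ∧ ∀ e ∈ S.sym2, L.colour e = c → v ∈ e := by
  simp only [priv, Finset.mem_sdiff, mem_palette, mem_sym2_erase]
  constructor
  · rintro ⟨⟨h0, h1⟩, h2⟩
    refine ⟨⟨h0, h1⟩, fun e he hc => ?_⟩
    by_contra hv
    exact h2 ⟨h0, e, ⟨he, hv⟩, hc⟩
  · rintro ⟨h1, h2⟩
    refine ⟨h1, ?_⟩
    rintro ⟨-, e, ⟨he, hv⟩, hc⟩
    exact hv (h2 e he hc)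

lemma count_erase_add_card_priv (S : Finset W) (v : W) :
    L.count (S.erase v) + (L.priv S v).card = L.count S := by
  have h := Finset.card_sdiff_add_card_eq_card
    (palette_mono (L := L) (Finset.erase_subset v S))
  unfold count priv
  omega

lemma count_empty : L.count ∅ = 0 := by
  simp [count, palette]

lemma count_le_card_sym2 (S : Finset W) : L.count S ≤ S.sym2.card :=
  (Finset.card_le_card (Finset.erase_subset _ _)).trans Finset.card_image_le

lemma exists_eq_of_mem_sym2 {S : Finset W} {v : W} {e : Sym2 W} (he : e ∈ S.sym2) (hv : v ∈ e) :
    ∃ u ∈ S, e = s(v, u) := by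
  obtain ⟨u, rfl⟩ := Sym2.mem_iff_exists.mp hv
  exact ⟨u, (Finset.mk_mem_sym2_iff.mp he).2, rfl⟩

lemma priv_subset_image (S : Finset W) (v : W) :
    L.priv S v ⊆ S.image (fun u => L.colour s(v, u)) := by
  intro c hc
  rw [mem_priv, mem_palette] at hc
  obtain ⟨⟨-, e, he, rfl⟩, h⟩ := hc
  obtain ⟨u, hu, rfl⟩ := exists_eq_of_mem_sym2 he (h e he rfl)
  exact Finset.mem_image_of_mem _ hu

lemma card_priv_le (S : Finset W) (v : W) : (L.priv S v).card ≤ S.card :=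
  (Finset.card_le_card (priv_subset_image S v)).trans Finset.card_image_le

lemma card_toFinset_le_two (e : Sym2 W) : e.toFinset.card ≤ 2 := by
  rcases em e.IsDiag with h | h
  · rw [Sym2.card_toFinset_of_isDiag e h]; norm_num
  · rw [Sym2.card_toFinset_of_not_isDiag e h]

/-- A colour is private to at most the two endpoints of any edge that carries it. -/
lemma sum_card_priv_le (S : Finset W) : ∑ v ∈ S, (L.priv S v).card ≤ 2 * L.count S := by
  have h1 : ∀ v ∈ S, (L.priv S v).card
      = (Finset.bipartiteAbove (fun v c => c ∈ L.priv S v) (L.palette S) v).card := by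
    intro v _
    congr 1
    ext c
    simp only [Finset.mem_bipartiteAbove]
    exact ⟨fun h => ⟨(mem_priv.mp h).1, h⟩, fun h => h.2⟩
  rw [Finset.sum_congr rfl h1, Finset.sum_card_bipartiteAbove_eq_sum_card_bipartiteBelow,
    mul_comm]
  refine Finset.sum_le_card_nsmul _ _ 2 fun c hc => ?_
  obtain ⟨-, e, he, hec⟩ := mem_palette.mp hc
  refine (Finset.card_le_card ?_).trans (card_toFinset_le_two e)
  intro v hv
  rw [Finset.mem_bipartiteBelow] at hv
  exact Sym2.mem_toFinset.mpr ((mem_priv.mp hv.2).2 e he hec)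

/-- A colour that is private to two different vertices occurs only on the edge between them. -/
lemma eq_of_mem_priv_inter {S : Finset W} {u v : W} (huv : u ≠ v) {c : C}
    (hu : c ∈ L.priv S u) (hv : c ∈ L.priv S v) :
    c = L.colour s(u, v) ∧ ∀ e ∈ S.sym2, L.colour e = c → e = s(u, v) := by
  have key : ∀ e ∈ S.sym2, L.colour e = c → e = s(u, v) := fun e he hc =>
    (Sym2.mem_and_mem_iff huv).mp ⟨(mem_priv.mp hu).2 e he hc, (mem_priv.mp hv).2 e he hc⟩
  obtain ⟨-, e, he, hec⟩ := mem_palette.mp (mem_priv.mp hu).1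
  exact ⟨by rw [← key e he hec, hec], key⟩

lemma card_priv_inter_le_one (S : Finset W) {u v : W} (huv : u ≠ v) :
    (L.priv S u ∩ L.priv S v).card ≤ 1 := by
  rw [Finset.card_le_one]
  intro a ha b hb
  rw [Finset.mem_inter] at ha hb
  rw [(eq_of_mem_priv_inter huv ha.1 ha.2).1, (eq_of_mem_priv_inter huv hb.1 hb.2).1]

lemma priv_sdiff_subset (S : Finset W) (u v : W) :
    L.priv S u \ L.priv S v ⊆ L.priv (S.erase v) u := by
  intro c hc
  rw [Finset.mem_sdiff] at hc
  obtain ⟨h1, h2⟩ := hc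
  have h3 := (mem_priv.mp h1)
  rw [mem_priv]
  refine ⟨?_, fun e he => h3.2 e (mem_sym2_erase.mp he).1⟩
  by_contra h
  exact h2 (Finset.mem_sdiff.mpr ⟨h3.1, h⟩)

lemma card_priv_le_erase_add_one (S : Finset W) {u v : W} (huv : u ≠ v) :
    (L.priv S u).card ≤ (L.priv (S.erase v) u).card + 1 := by
  have h1 := Finset.card_sdiff_add_card_inter (L.priv S u) (L.priv S v)
  have h2 := card_priv_inter_le_one (L := L) S huv
  have h3 := Finset.card_le_card (priv_sdiff_subset (L := L) S u v)
  omega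

lemma exists_reduced_subset (S : Finset W) :
    ∃ S' ⊆ S, L.count S' = L.count S ∧ L.Reduced S' := by
  induction S using Finset.strongInduction with
  | H S ih =>
    by_cases h : L.Reduced S
    · exact ⟨S, subset_rfl, rfl, h⟩
    · unfold Reduced at h
      push Not at h
      obtain ⟨v, hv, hp⟩ := h
      obtain ⟨S', h1, h2, h3⟩ := ih _ (Finset.erase_ssubset hv)
      have := count_erase_add_card_priv (L := L) S v
      rw [hp, Finset.card_empty] at this
      exact ⟨S', h1.trans (Finset.erase_subset _ _), by omega, h3⟩

lemma Reduced.one_le {S : Finset W} (h : L.Reduced S) {v : W} (hv : v ∈ S) :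
    1 ≤ (L.priv S v).card :=
  Finset.card_pos.mpr (h v hv)

/-- One step of the descent: removing a vertex with the fewest private colours, and possibly one
more vertex that has lost its only private colour, leaves a reduced set again. -/
lemma Reduced.exists_descent {S : Finset W} (h : L.Reduced S) (hS : S.Nonempty) :
    ∃ S' ⊂ S, L.Reduced S' ∧ S.card ≤ S'.card + 2 ∧ L.count S' < L.count S ∧
      (L.count S - L.count S') * S.card ≤ 2 * L.count S ∧
      ∀ w ∈ S, L.count S - L.count S' ≤ (L.priv S w).card := by
  obtain ⟨v, hv, hmin⟩ := Finset.exists_min_image S (fun v => (L.priv S v).card) hS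
  have hc := count_erase_add_card_priv (L := L) S v
  have h1 := h.one_le hv
  have hcard := Finset.card_erase_add_one hv
  have hsum : (L.priv S v).card * S.card ≤ 2 * L.count S := by
    refine le_trans ?_ (sum_card_priv_le S)
    rw [mul_comm]
    exact Finset.card_nsmul_le_sum _ _ _ hmin
  by_cases hr : L.Reduced (S.erase v)
  · refine ⟨S.erase v, Finset.erase_ssubset hv, hr, by omega, by omega, ?_, ?_⟩
    · rwa [← hc, Nat.add_sub_cancel_left, hc]
    · rwa [← hc, Nat.add_sub_cancel_left]
  · -- Some `u` has lost its only private colour, so every minimum is `1` and that colour is also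
    -- the only private colour of `v`; hence `u` is the only such vertex.
    unfold Reduced at hr
    push Not at hr
    obtain ⟨u, hu, hp⟩ := hr
    have huv := Finset.ne_of_mem_erase hu
    have hu' := Finset.mem_of_mem_erase hu
    have hsub : ∀ w ∈ S.erase v, L.priv (S.erase v) w = ∅ → L.priv S w ⊆ L.priv S v := by
      intro w _ hpw
      have := priv_sdiff_subset (L := L) S w v
      rw [hpw, Finset.subset_empty, Finset.sdiff_eq_empty_iff_subset] at this
      exact this
    have hv1 : (L.priv S v).card = 1 := by
      have h3 := card_priv_le_erase_add_one (L := L) S huv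
      rw [hp, Finset.card_empty] at h3
      have := hmin u hu'
      omega
    have hcu := count_erase_add_card_priv (L := L) (S.erase v) u
    rw [hp, Finset.card_empty] at hcu
    have hcard' := Finset.card_erase_add_one hu
    have hcount : L.count ((S.erase v).erase u) + 1 = L.count S := by omega
    refine ⟨(S.erase v).erase u,
      (Finset.erase_ssubset hu).trans (Finset.erase_ssubset hv), ?_, by omega, by omega, ?_, ?_⟩
    · intro w hw
      have hwu := Finset.ne_of_mem_erase hw
      have hw' := Finset.mem_of_mem_erase hw
      by_contra hne
      rw [Finset.not_nonempty_iff_eq_empty] at hne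
      have hcw := count_erase_add_card_priv (L := L) ((S.erase v).erase u) w
      rw [hne, Finset.card_empty] at hcw
      have hmono := count_mono (L := L)
        (Finset.erase_subset_erase w (Finset.erase_subset u (S.erase v)))
      have hcw' := count_erase_add_card_priv (L := L) (S.erase v) w
      have hpw : L.priv (S.erase v) w = ∅ := Finset.card_eq_zero.mp (by omega)
      obtain ⟨a, ha⟩ := h u hu'
      obtain ⟨b, hb⟩ := h w (Finset.mem_of_mem_erase hw')
      have hav := hsub u hu hp ha
      have hbv := hsub w hw' hpw hb
      have hab : a = b := Finset.card_le_one.mp hv1.le a hav b hbv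
      subst hab
      obtain ⟨-, e, he, hea⟩ := mem_palette.mp (mem_priv.mp ha).1
      have e1 := (eq_of_mem_priv_inter huv ha hav).2 e he hea
      have e2 := (mem_priv.mp hb).2 e he hea
      rw [e1, Sym2.mem_iff] at e2
      exact e2.elim hwu (Finset.ne_of_mem_erase hw')
    · have : L.count S - L.count ((S.erase v).erase u) = (L.priv S v).card := by omega
      rwa [this]
    · intro w hw
      have := hmin w hw
      omega

/-- Two vertices cannot each have two private colours if only two colours occur: both colours
would have to sit on the single edge between them. -/
lemma not_two_of_card_two {S : Finset W} (hS : S.card = 2) (hc : L.count S = 2)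
    (h : ∀ v ∈ S, 2 ≤ (L.priv S v).card) : False := by
  obtain ⟨u, v, huv, rfl⟩ := Finset.card_eq_two.mp hS
  have hu := h u (by simp)
  have hv := h v (by simp)
  have h1 := card_priv_inter_le_one (L := L) {u, v} huv
  have h2 := Finset.card_union_add_card_inter (L.priv {u, v} u) (L.priv {u, v} v)
  have h3 : (L.priv {u, v} u ∪ L.priv {u, v} v).card ≤ L.count {u, v} :=
    Finset.card_le_card (Finset.union_subset Finset.sdiff_subset Finset.sdiff_subset)
  omega

/-! ### Counting values -/

section Values

variable [Fintype W]

variable (L) in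
/-- The number of values of `L.count` that are at most `k`. -/
def numValues (k : ℕ) : ℕ :=
  (((Finset.univ : Finset (Finset W)).image L.count).filter (· ≤ k)).card

/-- Values in `(j, k]` add to the number of values at most `j`. -/
lemma numValues_add_card_le {j k : ℕ} (hjk : j ≤ k) (A : Finset ℕ)
    (hA : ∀ a ∈ A, j < a ∧ a ≤ k ∧ ∃ S, L.count S = a) :
    L.numValues j + A.card ≤ L.numValues k := by
  unfold numValues
  rw [← Finset.card_union_of_disjoint]
  · refine Finset.card_le_card fun a ha => ?_
    rw [Finset.mem_union, Finset.mem_filter] at ha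
    rw [Finset.mem_filter]
    rcases ha with ⟨h1, h2⟩ | h
    · exact ⟨h1, h2.trans hjk⟩
    · obtain ⟨-, h2, S, h3⟩ := hA a h
      exact ⟨Finset.mem_image.mpr ⟨S, Finset.mem_univ _, h3⟩, h2⟩
  · rw [Finset.disjoint_left]
    intro a ha hb
    have := (Finset.mem_filter.mp ha).2
    have := (hA a hb).1
    omega

lemma numValues_succ_le {S : Finset W} {j : ℕ} (h : j < L.count S) :
    L.numValues j + 1 ≤ L.numValues (L.count S) := by
  have := numValues_add_card_le (L := L) h.le {L.count S}
    (by simpa using h)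
  simpa using this

lemma one_le_numValues (k : ℕ) : 1 ≤ L.numValues k := by
  unfold numValues
  rw [Nat.one_le_iff_ne_zero, ← Nat.pos_iff_ne_zero, Finset.card_pos]
  exact ⟨0, Finset.mem_filter.mpr ⟨Finset.mem_image.mpr ⟨∅, Finset.mem_univ _, count_empty⟩,
    Nat.zero_le _⟩⟩

/-- There are at least about `√(2k)` values up to the number `k` of colours in `S`: the descent from
`S` costs at most as many colours as there are values below. -/
lemma two_mul_count_add_le_sq (S : Finset W) :
    2 * L.count S + L.numValues (L.count S) ≤ L.numValues (L.count S) ^ 2 := by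
  induction S using Finset.strongInduction with
  | H S ih =>
    obtain ⟨R, hRS, hR, hred⟩ := exists_reduced_subset (L := L) S
    rw [← hR]
    rcases R.eq_empty_or_nonempty with rfl | hne
    · rw [count_empty]
      nlinarith [one_le_numValues (L := L) 0]
    obtain ⟨S', hS', -, -, hlt, hmul, hmin⟩ := hred.exists_descent hne
    have hN := numValues_succ_le hlt
    have hI := ih S' (hS'.trans_subset hRS)
    have h1 := one_le_numValues (L := L) (L.count S')
    obtain ⟨v, hv⟩ := hne
    have hle : L.count R - L.count S' ≤ R.card := (hmin v hv).trans (card_priv_le R v)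
    set N := L.numValues (L.count R)
    set N' := L.numValues (L.count S')
    obtain ⟨d, hd⟩ : ∃ d, L.count R = L.count S' + d := ⟨_, (Nat.add_sub_of_le hlt.le).symm⟩
    have hsub : L.count R - L.count S' = d := by omega
    rw [hsub] at hmul hmin hle
    have hdN : d ≤ N' := by
      by_contra hcon
      push Not at hcon
      have h2 : d * d ≤ 2 * (L.count S' + d) := by
        rw [← hd]
        exact (Nat.mul_le_mul_left d hle).trans hmul
      have hN1 : N' = 1 := by nlinarith
      have hf0 : L.count S' = 0 := by rw [hN1] at hI; omega
      rw [hf0, zero_add] at h2 hd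
      have hd2 : d = 2 := by nlinarith
      rw [hd, hd2] at hmul
      rw [hd2] at hle hmin
      exact not_two_of_card_two (by omega) (hd.trans hd2) hmin
    rw [hd]
    nlinarith

/-! ### Many vertices and few colours -/

/-- Iterated descent: `t` steps yield `t` new values, and as long as at least `k` vertices are left
each of them costs at most a proportion `2 / k` of the colours. -/
lemma Reduced.exists_iterated_descent {S : Finset W} (h : L.Reduced S) {k : ℕ} (hk : 1 ≤ k)
    (t : ℕ) (ht : k + 2 * t ≤ S.card) :
    ∃ S', L.Reduced S' ∧ S.card ≤ S'.card + 2 * t ∧ L.count S' ≤ L.count S ∧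
      L.numValues (L.count S') + t ≤ L.numValues (L.count S) ∧
      (L.count S - L.count S') * k ≤ 2 * t * L.count S := by
  induction t with
  | zero => exact ⟨S, h, by omega, le_rfl, le_rfl, by simp⟩
  | succ t ih =>
    obtain ⟨S', hred, hcard, hle, hN, hmul⟩ := ih (by omega)
    obtain ⟨S'', -, hred', hcard', hlt, hmul', -⟩ :=
      hred.exists_descent (Finset.card_pos.mp (by omega))
    have hN' := numValues_succ_le hlt
    refine ⟨S'', hred', by omega, by omega, by omega, ?_⟩
    have h1 : L.count S - L.count S''
        = (L.count S - L.count S') + (L.count S' - L.count S'') := by omega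
    have h2 : (L.count S' - L.count S'') * k ≤ (L.count S' - L.count S'') * S'.card :=
      Nat.mul_le_mul_left _ (by omega)
    rw [h1, add_mul]
    nlinarith

/-- Comparing `t + √(r² - 2tr/(1+δ))` with `r`: for `t` of order `δ r` the gain is of order `δ² r`.
Here `δ = 1/2000`. -/
lemma le_add_of_descent {r t x : ℝ} (hr : 0 < r) (ht1 : t ≤ r / 4000) (ht2 : r / 5000 ≤ t)
    (hx : 0 ≤ x) (hxr : r ^ 2 - 2 * t * r / (1 + 1 / 2000) ≤ x ^ 2) :
    (1 + 1 / 20000000) * r ≤ x + t := by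
  by_contra hcon
  push Not at hcon
  have h1 : x < (1 + 1 / 20000000) * r - t := by linarith
  have h2 : x ^ 2 < ((1 + 1 / 20000000) * r - t) ^ 2 := by
    exact pow_lt_pow_left₀ h1 hx (by norm_num)
  have h3 : r / 5000 * r ≤ t * r := mul_le_mul_of_nonneg_right ht2 hr.le
  have h4 : t * t ≤ r / 4000 * t := mul_le_mul_of_nonneg_right ht1 (by linarith)
  have h5 : 2 * t * r / (1 + 1 / 2000) = 2000 / 2001 * (2 * (t * r)) := by ring
  have h6 := mul_pos hr hr
  have h7 : ((1 + 1 / 20000000) * r - t) ^ 2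
      = (1 + 1 / 20000000) ^ 2 * (r * r) - 2 * (1 + 1 / 20000000) * (t * r) + t * t := by ring
  have h8 : r / 5000 * r = 1 / 5000 * (r * r) := by ring
  have h9 : r / 4000 * t = 1 / 4000 * (t * r) := by ring
  rw [h5] at hxr
  rw [h7] at h2
  rw [h8] at h3
  rw [h9] at h4
  have h10 : r ^ 2 = r * r := sq r
  linarith

/-- If a reduced set has noticeably more than `√(2f)` vertices, where `f` is its number of colours,
then there are noticeably more than `√(2f)` values. -/
lemma Reduced.le_numValues_of_card_ge {S : Finset W} (h : L.Reduced S)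
    (hbig : 20000 ≤ Real.sqrt (2 * L.count S))
    (hcard : (1 + 1 / 1000) * Real.sqrt (2 * L.count S) ≤ S.card) :
    (1 + 1 / 20000000) * Real.sqrt (2 * L.count S) ≤ L.numValues (L.count S) := by
  set r := Real.sqrt (2 * L.count S) with hrdef
  have hr2 : r ^ 2 = 2 * L.count S := Real.sq_sqrt (by positivity)
  have hr : 0 < r := by linarith
  set t := ⌊r / 4000⌋₊
  have ht1 : (t : ℝ) ≤ r / 4000 := Nat.floor_le (by positivity)
  have ht2 : r / 4000 < t + 1 := Nat.lt_floor_add_one _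
  have hnat : 2 * t + 1 ≤ S.card := by
    have : (2 * (t : ℝ) + 1) ≤ S.card := by linarith
    exact_mod_cast this
  obtain ⟨k, hk⟩ := Nat.exists_eq_add_of_le hnat
  obtain ⟨S', -, -, hle, hN, hmul⟩ :=
    h.exists_iterated_descent (k := k + 1) (by omega) t (by omega)
  have hkr : (1 + 1 / 2000) * r ≤ (k + 1 : ℝ) := by
    have : (S.card : ℝ) = 2 * t + 1 + k := by exact_mod_cast hk
    linarith
  have hmul' : ((L.count S : ℝ) - L.count S') * (k + 1) ≤ t * r ^ 2 := by
    rw [hr2]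
    have := (Nat.cast_le (α := ℝ)).mpr hmul
    push_cast [Nat.cast_sub hle] at this
    linarith
  have hd : (0 : ℝ) ≤ (L.count S : ℝ) - L.count S' := by
    rw [sub_nonneg]; exact_mod_cast hle
  have hd2 : ((L.count S : ℝ) - L.count S') * (1 + 1 / 2000) ≤ t * r := by
    have h1 := mul_le_mul_of_nonneg_left hkr hd
    have h2 : (((L.count S : ℝ) - L.count S') * (1 + 1 / 2000)) * r ≤ (t * r) * r := by
      nlinarith
    exact le_of_mul_le_mul_right h2 hr
  have hA := (Nat.cast_le (α := ℝ)).mpr (two_mul_count_add_le_sq (L := L) S')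
  push_cast at hA
  have hN' : ((L.numValues (L.count S') : ℝ)) + t ≤ L.numValues (L.count S) := by
    exact_mod_cast hN
  refine le_trans (le_add_of_descent hr ht1 (by linarith) (Nat.cast_nonneg _) ?_) hN'
  have h0 : (0 : ℝ) ≤ L.numValues (L.count S') := Nat.cast_nonneg _
  have h1 : (L.count S : ℝ) - L.count S' ≤ t * r / (1 + 1 / 2000) := by
    rwa [le_div_iff₀ (by norm_num)]
  have h2 : 2 * (t : ℝ) * r / (1 + 1 / 2000) = 2 * (t * r / (1 + 1 / 2000)) := by ring
  rw [h2]
  linarith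

end Values

/-! ### Almost rainbow sets -/

variable (L) in
/-- The edges and loops of `S` that are coloured `blank` or share their colour with another edge
or loop of `S`. -/
def clashes (S : Finset W) : Finset (Sym2 W) :=
  S.sym2.filter fun e =>
    L.colour e = L.blank ∨ ∃ e' ∈ S.sym2, L.colour e' = L.colour e ∧ e' ≠ e

variable (L) in
/-- The clashes at the vertex `v`. -/
def clashesAt (S : Finset W) (v : W) : Finset (Sym2 W) :=
  (L.clashes S).filter (v ∈ ·)

variable (L) in
/-- All but at most `|S|² / 200` edges and loops of `S` are needed to display its colours. -/
def NearRainbow (S : Finset W) : Prop :=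
  200 * S.sym2.card ≤ 200 * L.count S + S.card ^ 2

lemma notMem_clashes {S : Finset W} {e : Sym2 W} (he : e ∈ S.sym2) :
    e ∉ L.clashes S ↔
      L.colour e ≠ L.blank ∧ ∀ e' ∈ S.sym2, L.colour e' = L.colour e → e' = e := by
  simp only [clashes, Finset.mem_filter, he, true_and, not_or, not_exists, not_and, not_not, ne_eq]

/-- Every non-blank colour on a clash lies on at least two clashes. -/
lemma card_clashes_add_le (S : Finset W) :
    (L.clashes S).card + 2 * L.count S ≤ 2 * S.sym2.card := by
  have hsub : L.clashes S ⊆ S.sym2 := Finset.filter_subset _ _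
  have h1 : L.palette S ⊆ (S.sym2 \ L.clashes S).image L.colour ∪
      ((L.clashes S).image L.colour).erase L.blank := by
    intro c hc
    obtain ⟨h0, e, he, rfl⟩ := mem_palette.mp hc
    rw [Finset.mem_union]
    by_cases h : e ∈ L.clashes S
    · exact Or.inr (Finset.mem_erase.mpr ⟨h0, Finset.mem_image_of_mem _ h⟩)
    · exact Or.inl (Finset.mem_image_of_mem _ (Finset.mem_sdiff.mpr ⟨he, h⟩))
  have h2 : 2 * (((L.clashes S).image L.colour).erase L.blank).card ≤ (L.clashes S).card := by
    have h3 : 2 * (((L.clashes S).image L.colour).erase L.blank).card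
        ≤ ((L.clashes S).filter (fun e => L.colour e ≠ L.blank)).card := by
      refine Finset.mul_card_image_le_card_of_maps_to (f := L.colour) ?_ 2 ?_
      · intro e he
        rw [Finset.mem_filter] at he
        exact Finset.mem_erase.mpr ⟨he.2, Finset.mem_image_of_mem _ he.1⟩
      · intro c hc
        obtain ⟨h0, hc⟩ := Finset.mem_erase.mp hc
        obtain ⟨e, he, rfl⟩ := Finset.mem_image.mp hc
        obtain ⟨he1, he2⟩ := Finset.mem_filter.mp he
        obtain ⟨e', he', hcol, hne⟩ := he2.resolve_left h0
        have he'c : e' ∈ L.clashes S :=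
          Finset.mem_filter.mpr ⟨he', Or.inr ⟨e, he1, hcol.symm, hne.symm⟩⟩
        have : ({e, e'} : Finset (Sym2 W)).card = 2 := Finset.card_pair hne.symm
        rw [← this]
        refine Finset.card_le_card fun x hx => ?_
        rw [Finset.mem_insert, Finset.mem_singleton] at hx
        rcases hx with rfl | rfl
        · simp [he, h0]
        · simp [he'c, hcol, h0]
    exact h3.trans (Finset.card_filter_le _ _)
  have h3 := (Finset.card_le_card h1).trans (Finset.card_union_le _ _)
  have h4 := Finset.card_sdiff_add_card_eq_card hsub
  have h5 : ((S.sym2 \ L.clashes S).image L.colour).card ≤ (S.sym2 \ L.clashes S).card :=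
    Finset.card_image_le
  unfold count
  omega

lemma card_le_card_priv_add (S : Finset W) {v : W} (hv : v ∈ S) :
    S.card ≤ (L.priv S v).card + (L.clashesAt S v).card := by
  have hinj : Function.Injective (fun u : W => s(v, u)) := fun a b h => Sym2.congr_right.mp h
  have h1 : (S.image (fun u => s(v, u))).card = S.card := Finset.card_image_of_injective _ hinj
  have hmem : ∀ e ∈ S.image (fun u => s(v, u)) \ L.clashesAt S v,
      e ∈ S.sym2 ∧ v ∈ e ∧ e ∉ L.clashes S := by
    intro e he
    obtain ⟨h2, h3⟩ := Finset.mem_sdiff.mp he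
    obtain ⟨u, hu, rfl⟩ := Finset.mem_image.mp h2
    refine ⟨Finset.mk_mem_sym2_iff.mpr ⟨hv, hu⟩, Sym2.mem_mk_left _ _, fun h => h3 ?_⟩
    exact Finset.mem_filter.mpr ⟨h, Sym2.mem_mk_left _ _⟩
  have h2 : (S.image (fun u => s(v, u)) \ L.clashesAt S v).card ≤ (L.priv S v).card := by
    refine Finset.card_le_card_of_injOn L.colour ?_ ?_
    · intro e he
      obtain ⟨h3, h4, h5⟩ := hmem e he
      rw [notMem_clashes h3] at h5
      refine mem_priv.mpr ⟨mem_palette.mpr ⟨h5.1, e, h3, rfl⟩, fun e' he' hc => ?_⟩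
      rwa [h5.2 e' he' hc]
    · intro e he e' he' hee
      obtain ⟨h3, -, h5⟩ := hmem e he
      obtain ⟨h3', -, -⟩ := hmem e' he'
      exact (((notMem_clashes h3).mp h5).2 e' h3' hee.symm).symm
  have h3 := Finset.card_le_card_sdiff_add_card
    (s := S.image (fun u => s(v, u))) (t := L.clashesAt S v)
  omega

lemma sum_card_clashesAt_le (S : Finset W) :
    ∑ v ∈ S, (L.clashesAt S v).card ≤ 2 * (L.clashes S).card := by
  have := Finset.sum_card_bipartiteAbove_eq_sum_card_bipartiteBelow
    (s := S) (t := L.clashes S) (fun v e => v ∈ e)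
  unfold clashesAt
  unfold Finset.bipartiteAbove at this
  rw [this, mul_comm]
  refine Finset.sum_le_card_nsmul _ _ 2 fun e _ => ?_
  refine (Finset.card_le_card ?_).trans (card_toFinset_le_two e)
  intro v hv
  exact Sym2.mem_toFinset.mpr (Finset.mem_bipartiteBelow _ |>.mp hv).2

variable (L) in
/-- The vertices of `S` at which more than a tenth of the edges are clashes. -/
def poor (S : Finset W) : Finset W :=
  S.filter fun v => S.card < 10 * (L.clashesAt S v).card

lemma NearRainbow.card_poor_le {S : Finset W} (h : L.NearRainbow S) :
    5 * (L.poor S).card ≤ S.card := by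
  rcases Nat.eq_zero_or_pos S.card with h0 | h0
  · have := Finset.card_filter_le S fun v => S.card < 10 * (L.clashesAt S v).card
    unfold poor
    omega
  have h1 : (L.poor S).card * S.card ≤ 10 * ∑ v ∈ S, (L.clashesAt S v).card := by
    rw [Finset.mul_sum]
    refine le_trans ?_ (Finset.sum_le_sum_of_subset (Finset.filter_subset _ _ : L.poor S ⊆ S))
    exact Finset.card_nsmul_le_sum _ _ _ fun v hv => (Finset.mem_filter.mp hv).2.le
  have h2 := sum_card_clashesAt_le (L := L) S
  have h3 := card_clashes_add_le (L := L) S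
  unfold NearRainbow at h
  have h4 : (5 * (L.poor S).card) * S.card ≤ S.card * S.card := by nlinarith
  exact Nat.le_of_mul_le_mul_right h4 h0

lemma card_priv_of_notMem_poor {S : Finset W} {v : W} (hv : v ∈ S) (hp : v ∉ L.poor S) :
    9 * S.card ≤ 10 * (L.priv S v).card := by
  have h1 : ¬ S.card < 10 * (L.clashesAt S v).card := fun h =>
    hp (Finset.mem_filter.mpr ⟨hv, h⟩)
  have h2 := card_le_card_priv_add (L := L) S hv
  omega

/-- In an almost rainbow set some vertex, outside any prescribed small set, has many private
colours and can be removed without depriving another vertex of its last private colour. -/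
lemma NearRainbow.exists_erase {S T : Finset W} (h : L.NearRainbow S) (hred : L.Reduced S)
    (hS : 100 ≤ S.card) (hT : T.card ≤ 8) :
    ∃ v ∈ S, v ∉ T ∧ 9 * S.card ≤ 10 * (L.priv S v).card ∧ L.Reduced (S.erase v) := by
  -- For every poor vertex `u` keep both ends of one edge with a colour private to `u`.
  have hex : ∀ u, ∃ e : Sym2 W, u ∈ S → e ∈ S.sym2 ∧ L.colour e ∈ L.priv S u := by
    intro u
    by_cases hu : u ∈ S
    · obtain ⟨c, hc⟩ := hred u hu
      obtain ⟨-, e, he, rfl⟩ := mem_palette.mp (mem_priv.mp hc).1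
      exact ⟨e, fun _ => ⟨he, hc⟩⟩
    · exact ⟨s(u, u), fun h => absurd h hu⟩
  choose φ hφ using hex
  set F := T ∪ (L.poor S).biUnion (fun u => (φ u).toFinset) with hF
  have hFc : F.card < S.card := by
    have h1 := Finset.card_union_le T ((L.poor S).biUnion (fun u => (φ u).toFinset))
    have h2 : ((L.poor S).biUnion (fun u => (φ u).toFinset)).card ≤ (L.poor S).card * 2 :=
      Finset.card_biUnion_le_card_mul _ _ _ fun u _ => card_toFinset_le_two _
    have h3 := h.card_poor_le
    rw [← hF] at h1
    omega
  obtain ⟨v, hv, hvF⟩ := Finset.exists_mem_notMem_of_card_lt_card hFc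
  rw [hF, Finset.mem_union, not_or] at hvF
  have hφv : ∀ u ∈ L.poor S, v ∉ φ u := fun u hu hm =>
    hvF.2 (Finset.mem_biUnion.mpr ⟨u, hu, Sym2.mem_toFinset.mpr hm⟩)
  have hvp : v ∉ L.poor S := fun hp =>
    hφv v hp ((mem_priv.mp (hφ v hv).2).2 _ (hφ v hv).1 rfl)
  refine ⟨v, hv, hvF.1, card_priv_of_notMem_poor hv hvp, fun u hu => ?_⟩
  have huv := Finset.ne_of_mem_erase hu
  have huS := Finset.mem_of_mem_erase hu
  by_cases hup : u ∈ L.poor S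
  · obtain ⟨h1, h2⟩ := hφ u huS
    refine ⟨L.colour (φ u), mem_priv.mpr ⟨mem_palette.mpr ⟨(mem_palette.mp
      (mem_priv.mp h2).1).1, φ u, mem_sym2_erase.mpr ⟨h1, hφv u hup⟩, rfl⟩, fun e he => ?_⟩⟩
    exact (mem_priv.mp h2).2 e (mem_sym2_erase.mp he).1
  · have h1 := card_priv_of_notMem_poor huS hup
    have h2 := card_priv_le_erase_add_one (L := L) S huv
    exact Finset.card_pos.mp (by omega)

/-- If removing one or two vertices always costs the same number of colours, then every edge of an
almost rainbow set has a colour of its own: this is so for most pairs, for which the two vertices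
together own exactly one colour less than the sum of their private numbers, and constancy
transfers it to all pairs. -/
lemma NearRainbow.notMem_clashes_of_const {S : Finset W} (h : L.NearRainbow S)
    (hS : 100 ≤ S.card) {d q : ℕ} (hd : ∀ v ∈ S, (L.priv S v).card = d)
    (hq : ∀ u ∈ S, ∀ w ∈ S, u ≠ w → L.count ((S.erase u).erase w) = q)
    {u w : W} (hu : u ∈ S) (hw : w ∈ S) (huw : u ≠ w) : s(u, w) ∉ L.clashes S := by
  have hpsub : ∀ a b, L.priv S a ∪ L.priv S b ⊆
      L.palette S \ L.palette ((S.erase a).erase b) := by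
    intro a b c hc
    rcases Finset.mem_union.mp hc with hc | hc
    · exact Finset.mem_sdiff.mpr ⟨(mem_priv.mp hc).1, fun hm => (Finset.mem_sdiff.mp hc).2
        (palette_mono (Finset.erase_subset _ _) hm)⟩
    · exact Finset.mem_sdiff.mpr ⟨(mem_priv.mp hc).1, fun hm => (Finset.mem_sdiff.mp hc).2
        (palette_mono (Finset.erase_subset_erase _ (Finset.erase_subset _ _)) hm)⟩
  have hpc : ∀ a b, (L.palette S \ L.palette ((S.erase a).erase b)).card
      + L.count ((S.erase a).erase b) = L.count S := fun a b =>
    Finset.card_sdiff_add_card_eq_card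
      (palette_mono ((Finset.erase_subset _ _).trans (Finset.erase_subset _ _)))
  -- A vertex `a` with few clashes, and a partner `b` avoiding, for every clash `e` at `a`, both `e`
  -- and an edge off `a` with the same colour.
  have hpoor := h.card_poor_le
  obtain ⟨a, ha, hap⟩ := Finset.exists_mem_notMem_of_card_lt_card
    (s := L.poor S) (t := S) (by omega)
  have hca : 10 * (L.clashesAt S a).card ≤ S.card := by
    by_contra hcon
    exact hap (Finset.mem_filter.mpr ⟨ha, by omega⟩)
  have hex : ∀ e : Sym2 W, ∃ e' : Sym2 W,
      (∃ x ∈ S.sym2, L.colour x = L.colour e ∧ a ∉ x) →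
        e' ∈ S.sym2 ∧ L.colour e' = L.colour e ∧ a ∉ e' := by
    intro e
    by_cases hx : ∃ x ∈ S.sym2, L.colour x = L.colour e ∧ a ∉ x
    · obtain ⟨x, h1⟩ := hx
      exact ⟨x, fun _ => h1⟩
    · exact ⟨e, fun h => absurd h hx⟩
  choose φ hφ using hex
  set F := insert a ((L.clashesAt S a).biUnion (fun e => e.toFinset ∪ (φ e).toFinset)) with hF
  have hFc : F.card < S.card := by
    have h1 := Finset.card_insert_le a
      ((L.clashesAt S a).biUnion (fun e => e.toFinset ∪ (φ e).toFinset))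
    have h2 : ((L.clashesAt S a).biUnion (fun e => e.toFinset ∪ (φ e).toFinset)).card
        ≤ (L.clashesAt S a).card * 4 :=
      Finset.card_biUnion_le_card_mul _ _ _ fun e _ => by
        have h3 := Finset.card_union_le e.toFinset (φ e).toFinset
        have h4 := card_toFinset_le_two e
        have h5 := card_toFinset_le_two (φ e)
        omega
    rw [← hF] at h1
    omega
  obtain ⟨b, hb, hbF⟩ := Finset.exists_mem_notMem_of_card_lt_card hFc
  rw [hF, Finset.mem_insert, not_or] at hbF
  obtain ⟨hba, hbF⟩ := hbF
  have hbe : ∀ e ∈ L.clashesAt S a, b ∉ e ∧ b ∉ φ e := by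
    intro e he
    constructor <;> intro hm <;> refine hbF (Finset.mem_biUnion.mpr ⟨e, he, ?_⟩)
    · exact Finset.mem_union_left _ (Sym2.mem_toFinset.mpr hm)
    · exact Finset.mem_union_right _ (Sym2.mem_toFinset.mpr hm)
  have habS : s(a, b) ∈ S.sym2 := Finset.mk_mem_sym2_iff.mpr ⟨ha, hb⟩
  have hab : s(a, b) ∉ L.clashes S := fun hm =>
    (hbe _ (Finset.mem_filter.mpr ⟨hm, Sym2.mem_mk_left _ _⟩)).1 (Sym2.mem_mk_right _ _)
  have hab' := (notMem_clashes habS).mp hab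
  have hsup : L.palette S \ L.palette ((S.erase a).erase b) ⊆ L.priv S a ∪ L.priv S b := by
    intro c hc
    obtain ⟨hc1, hc2⟩ := Finset.mem_sdiff.mp hc
    by_contra hcon
    rw [Finset.mem_union, not_or, mem_priv, mem_priv] at hcon
    obtain ⟨hca, hcb⟩ := hcon
    push Not at hca hcb
    obtain ⟨e', he', hec', hae'⟩ := hca hc1
    obtain ⟨e, he, hec, hbe'⟩ := hcb hc1
    have hcov : ∀ x ∈ S.sym2, L.colour x = c → a ∉ x → b ∈ x := by
      intro x hx hxc hax
      by_contra hbx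
      exact hc2 (mem_palette.mpr ⟨(mem_palette.mp hc1).1, x,
        mem_sym2_erase.mpr ⟨mem_sym2_erase.mpr ⟨hx, hax⟩, hbx⟩, hxc⟩)
    have hae : a ∈ e := by
      by_contra hae
      exact hbe' (hcov e he hec hae)
    have hcl : e ∈ L.clashesAt S a := by
      refine Finset.mem_filter.mpr ⟨Finset.mem_filter.mpr
        ⟨he, Or.inr ⟨e', he', hec'.trans hec.symm, ?_⟩⟩, hae⟩
      rintro rfl
      exact hae' hae
    obtain ⟨h1, h2, h3⟩ := hφ e ⟨e', he', hec'.trans hec.symm, hae'⟩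
    exact (hbe e hcl).2 (hcov _ h1 (h2.trans hec) h3)
  have hinter : (L.colour s(a, b)) ∈ L.priv S a ∩ L.priv S b := by
    rw [Finset.mem_inter, mem_priv, mem_priv]
    have hp : L.colour s(a, b) ∈ L.palette S := mem_palette.mpr ⟨hab'.1, _, habS, rfl⟩
    refine ⟨⟨hp, fun e he hc => ?_⟩, ⟨hp, fun e he hc => ?_⟩⟩ <;> rw [hab'.2 e he hc] <;> simp
  have h1 := Finset.card_union_add_card_inter (L.priv S a) (L.priv S b)
  have h2 := Finset.card_le_card hsup
  have h3 : 1 ≤ (L.priv S a ∩ L.priv S b).card := Finset.card_pos.mpr ⟨_, hinter⟩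
  have h4 := hpc a b
  have h1' := Finset.card_union_add_card_inter (L.priv S u) (L.priv S w)
  have h2' := Finset.card_le_card (hpsub u w)
  have h4' := hpc u w
  rw [hq a ha b hb (Ne.symm hba)] at h4
  rw [hq u hu w hw huw] at h4'
  rw [hd a ha, hd b hb] at h1
  rw [hd u hu, hd w hw] at h1'
  obtain ⟨c, hc⟩ := Finset.card_pos.mp (show 0 < (L.priv S u ∩ L.priv S w).card by omega)
  rw [Finset.mem_inter] at hc
  obtain ⟨h5, h6⟩ := eq_of_mem_priv_inter huw hc.1 hc.2
  rw [notMem_clashes (Finset.mk_mem_sym2_iff.mpr ⟨hu, hw⟩), ← h5]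
  exact ⟨(mem_palette.mp (mem_priv.mp hc.1).1).1, h6⟩

/-! ### Bad sets -/

variable (L) in
/-- All edges and loops of `S` have different colours, none of them `blank`. -/
def RainbowLooped (S : Finset W) : Prop :=
  (∀ e ∈ S.sym2, L.colour e ≠ L.blank) ∧
    ∀ e ∈ S.sym2, ∀ e' ∈ S.sym2, L.colour e' = L.colour e → e' = e

variable (L) in
/-- The edges of `S` have different colours, none of them `blank`, and the loops of `S` carry at
most one colour besides `blank`, which does not occur on the edges. -/
def RainbowUnlooped (S : Finset W) : Prop :=
  (∀ e ∈ S.sym2, ¬ e.IsDiag → L.colour e ≠ L.blank) ∧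
    (∀ e ∈ S.sym2, ¬ e.IsDiag → ∀ e' ∈ S.sym2, ¬ e'.IsDiag → L.colour e' = L.colour e → e' = e) ∧
    ∃ c, (∀ e ∈ S.sym2, ¬ e.IsDiag → L.colour e ≠ c) ∧
      ∀ v ∈ S, L.colour s(v, v) = L.blank ∨ L.colour s(v, v) = c

lemma RainbowLooped.mono {S T : Finset W} (h : S ⊆ T) (hT : L.RainbowLooped T) :
    L.RainbowLooped S :=
  have hs := Finset.sym2_mono h
  ⟨fun e he => hT.1 e (hs he), fun e he e' he' => hT.2 e (hs he) e' (hs he')⟩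

lemma RainbowUnlooped.mono {S T : Finset W} (h : S ⊆ T) (hT : L.RainbowUnlooped T) :
    L.RainbowUnlooped S := by
  have hs := Finset.sym2_mono h
  obtain ⟨h1, h2, c, h3, h4⟩ := hT
  exact ⟨fun e he => h1 e (hs he), fun e he hd e' he' => h2 e (hs he) hd e' (hs he'),
    c, fun e he => h3 e (hs he), fun v hv => h4 v (h hv)⟩

lemma toFinset_subset_of_mem_sym2 {S : Finset W} {e : Sym2 W} (he : e ∈ S.sym2) :
    e.toFinset ⊆ S := fun a ha =>
  Finset.mem_sym2_iff.mp he a (Sym2.mem_toFinset.mp ha)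

lemma mem_sym2_of_toFinset_subset {S : Finset W} {e : Sym2 W} (he : e.toFinset ⊆ S) :
    e ∈ S.sym2 :=
  Finset.mem_sym2_iff.mpr fun _ ha => he (Sym2.mem_toFinset.mpr ha)

lemma exists_small_not_rainbowLooped {S : Finset W} (h : ¬ L.RainbowLooped S) :
    ∃ T ⊆ S, T.card ≤ 4 ∧ ¬ L.RainbowLooped T := by
  unfold RainbowLooped at h
  rw [not_and_or] at h
  push Not at h
  rcases h with ⟨e, he, hb⟩ | ⟨e, he, e', he', hc, hne⟩
  · exact ⟨e.toFinset, toFinset_subset_of_mem_sym2 he, (card_toFinset_le_two e).trans (by norm_num),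
      fun hT => hT.1 e (mem_sym2_of_toFinset_subset subset_rfl) hb⟩
  · refine ⟨e.toFinset ∪ e'.toFinset, Finset.union_subset (toFinset_subset_of_mem_sym2 he)
      (toFinset_subset_of_mem_sym2 he'), ?_, fun hT => ?_⟩
    · have h1 := card_toFinset_le_two e
      have h2 := card_toFinset_le_two e'
      have h3 := Finset.card_union_le e.toFinset e'.toFinset
      omega
    · exact hne (hT.2 e (mem_sym2_of_toFinset_subset Finset.subset_union_left) e'
        (mem_sym2_of_toFinset_subset Finset.subset_union_right) hc)

lemma exists_small_not_rainbowUnlooped {S : Finset W} (h : ¬ L.RainbowUnlooped S) :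
    ∃ T ⊆ S, T.card ≤ 4 ∧ ¬ L.RainbowUnlooped T := by
  by_cases h1 : ∃ e ∈ S.sym2, ¬ e.IsDiag ∧ L.colour e = L.blank
  · obtain ⟨e, he, hd, hb⟩ := h1
    exact ⟨e.toFinset, toFinset_subset_of_mem_sym2 he, (card_toFinset_le_two e).trans (by norm_num),
      fun hT => hT.1 e (mem_sym2_of_toFinset_subset subset_rfl) hd hb⟩
  by_cases h2 : ∃ e ∈ S.sym2, ¬ e.IsDiag ∧ ∃ e' ∈ S.sym2, ¬ e'.IsDiag ∧
      L.colour e' = L.colour e ∧ e' ≠ e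
  · obtain ⟨e, he, hd, e', he', hd', hc, hne⟩ := h2
    refine ⟨e.toFinset ∪ e'.toFinset, Finset.union_subset (toFinset_subset_of_mem_sym2 he)
      (toFinset_subset_of_mem_sym2 he'), ?_, fun hT => ?_⟩
    · have h1 := card_toFinset_le_two e
      have h2 := card_toFinset_le_two e'
      have h3 := Finset.card_union_le e.toFinset e'.toFinset
      omega
    · exact hne (hT.2.1 e (mem_sym2_of_toFinset_subset Finset.subset_union_left) hd e'
        (mem_sym2_of_toFinset_subset Finset.subset_union_right) hd' hc)
  push Not at h1 h2
  have h3 : ∀ c, (∀ e ∈ S.sym2, ¬ e.IsDiag → L.colour e ≠ c) →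
      ∃ v ∈ S, L.colour s(v, v) ≠ L.blank ∧ L.colour s(v, v) ≠ c := by
    intro c hc
    by_contra hcon
    push Not at hcon
    exact h ⟨h1, h2, c, hc, fun v hv => or_iff_not_imp_left.mpr (hcon v hv)⟩
  obtain ⟨v, hv, hvb, -⟩ := h3 L.blank h1
  by_cases h4 : ∃ e ∈ S.sym2, ¬ e.IsDiag ∧ L.colour e = L.colour s(v, v)
  · obtain ⟨e, he, hd, hc⟩ := h4
    refine ⟨insert v e.toFinset, Finset.insert_subset hv (toFinset_subset_of_mem_sym2 he), ?_, ?_⟩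
    · have h5 := card_toFinset_le_two e
      have h6 := Finset.card_insert_le v e.toFinset
      omega
    · rintro ⟨-, -, c, hc1, hc2⟩
      have h5 := (hc2 v (Finset.mem_insert_self _ _)).resolve_left hvb
      exact hc1 e (mem_sym2_of_toFinset_subset (Finset.subset_insert _ _)) hd (hc.trans h5)
  · push Not at h4
    obtain ⟨w, hw, hwb, hwv⟩ := h3 _ h4
    refine ⟨{v, w}, Finset.insert_subset hv (Finset.singleton_subset_iff.mpr hw),
      Finset.card_le_two.trans (by norm_num), ?_⟩
    rintro ⟨-, -, c, -, hc2⟩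
    exact hwv (((hc2 w (by simp)).resolve_left hwb).trans
      ((hc2 v (by simp)).resolve_left hvb).symm)

/-! ### Sets whose edges have colours of their own -/

lemma mem_sym2_of_mem {S : Finset W} {u v : W} (hu : u ∈ S) (hv : v ∈ S) : s(u, v) ∈ S.sym2 :=
  Finset.mk_mem_sym2_iff.mpr ⟨hu, hv⟩

variable (L) in
/-- Every edge of `S` (loops excepted) has a non-blank colour that occurs nowhere else in `S`. -/
def ProperEdges (S : Finset W) : Prop :=
  ∀ u ∈ S, ∀ v ∈ S, u ≠ v → s(u, v) ∉ L.clashes S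

lemma ProperEdges.notMem_clashes {S : Finset W} (h : L.ProperEdges S) {e : Sym2 W}
    (he : e ∈ S.sym2) (hd : ¬ e.IsDiag) : e ∉ L.clashes S := by
  induction e using Sym2.ind with
  | _ u v =>
    rw [Finset.mk_mem_sym2_iff] at he
    exact h u he.1 v he.2 (fun huv => hd (Sym2.mk_isDiag_iff.mpr huv))

variable (L) in
/-- The colours other than `blank` on the loops of `S`. -/
def loopPalette (S : Finset W) : Finset C :=
  (S.image fun v => L.colour s(v, v)).erase L.blank

lemma card_filter_not_isDiag (X : Finset W) :
    (X.sym2.filter fun e => ¬ e.IsDiag).card = X.card.choose 2 := by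
  have h1 := Finset.card_filter_add_card_filter_not (s := X.sym2) (fun e => e.IsDiag)
  have h2 : X.sym2.filter (fun e => e.IsDiag) = X.image (fun v => s(v, v)) := by
    ext e
    induction e using Sym2.ind with
    | _ u v =>
      simp only [Finset.mem_filter, Finset.mk_mem_sym2_iff, Sym2.mk_isDiag_iff, Finset.mem_image]
      constructor
      · rintro ⟨⟨hu, -⟩, rfl⟩
        exact ⟨u, hu, rfl⟩
      · rintro ⟨x, hx, hxe⟩
        rw [Sym2.eq_iff] at hxe
        rcases hxe with ⟨rfl, rfl⟩ | ⟨rfl, rfl⟩ <;> exact ⟨⟨hx, hx⟩, rfl⟩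
  have h3 : (X.image (fun v => s(v, v))).card = X.card :=
    Finset.card_image_of_injective _ fun a b h => by simpa using h
  rw [h2, h3, Finset.card_sym2, Nat.choose_succ_succ' _ 1, Nat.choose_one_right, one_add_one_eq_two] at h1
  omega

lemma ProperEdges.count_eq {S X : Finset W} (h : L.ProperEdges S) (hX : X ⊆ S) :
    L.count X = X.card.choose 2 + (L.loopPalette X).card := by
  have hs := Finset.sym2_mono hX
  have hmem : ∀ e ∈ X.sym2.filter (fun e => ¬ e.IsDiag), L.colour e ≠ L.blank ∧
      ∀ e' ∈ S.sym2, L.colour e' = L.colour e → e' = e := fun e he => by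
    obtain ⟨h1, h2⟩ := Finset.mem_filter.mp he
    exact (LoopedColouring.notMem_clashes (hs h1)).mp (h.notMem_clashes (hs h1) h2)
  have h1 : L.palette X
      = (X.sym2.filter fun e => ¬ e.IsDiag).image L.colour ∪ L.loopPalette X := by
    ext c
    rw [mem_palette, Finset.mem_union, Finset.mem_image, loopPalette, Finset.mem_erase,
      Finset.mem_image]
    constructor
    · rintro ⟨h0, e, he, rfl⟩
      by_cases hd : e.IsDiag
      · right
        induction e using Sym2.ind with
        | _ u v =>
          rw [Sym2.mk_isDiag_iff] at hd
          subst hd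
          exact ⟨h0, u, (Finset.mk_mem_sym2_iff.mp he).1, rfl⟩
      · exact Or.inl ⟨e, Finset.mem_filter.mpr ⟨he, hd⟩, rfl⟩
    · rintro (⟨e, he, rfl⟩ | ⟨h0, v, hv, rfl⟩)
      · exact ⟨(hmem e he).1, e, (Finset.mem_filter.mp he).1, rfl⟩
      · exact ⟨h0, _, mem_sym2_of_mem hv hv, rfl⟩
  have h2 : Disjoint ((X.sym2.filter fun e => ¬ e.IsDiag).image L.colour) (L.loopPalette X) := by
    rw [Finset.disjoint_left]
    intro c hc hc'
    obtain ⟨e, he, rfl⟩ := Finset.mem_image.mp hc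
    obtain ⟨v, hv, hvc⟩ := Finset.mem_image.mp (Finset.mem_of_mem_erase hc')
    have := (hmem e he).2 _ (mem_sym2_of_mem (hX hv) (hX hv)) hvc
    exact (Finset.mem_filter.mp he).2 (this ▸ Sym2.diag_isDiag v)
  rw [count, h1, Finset.card_union_of_disjoint h2, Finset.card_image_of_injOn,
    card_filter_not_isDiag]
  intro e he e' he' hee
  exact (hmem e' he').2 e (hs (Finset.mem_filter.mp he).1) hee

lemma ProperEdges.count_insert {S X : Finset W} (h : L.ProperEdges S) {v : W} (hv : v ∈ S)
    (hX : X ⊆ S) (hvX : v ∉ X) : L.count X + X.card ≤ L.count (insert v X) := by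
  rw [h.count_eq hX, h.count_eq (Finset.insert_subset hv hX), Finset.card_insert_of_notMem hvX,
    Nat.choose_succ_succ' _ 1, Nat.choose_one_right, one_add_one_eq_two]
  have : (L.loopPalette X).card ≤ (L.loopPalette (insert v X)).card :=
    Finset.card_le_card (Finset.erase_subset_erase _
      (Finset.image_subset_image (Finset.subset_insert _ _)))
  omega

section PairedValues

variable [Fintype W]

/-- If two loops `a`, `b` share a colour and a loop `w` has another one, then on sets avoiding the
colour of `w` the values come in consecutive pairs: exchanging `a` for `w` adds one colour. -/
lemma ProperEdges.le_numValues {S : Finset W} (h : L.ProperEdges S) {a b w : W} (ha : a ∈ S)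
    (hb : b ∈ S) (hw : w ∈ S) (hab : a ≠ b) (hcab : L.colour s(a, a) = L.colour s(b, b))
    (hwb : L.colour s(w, w) ≠ L.blank)
    (hwa : L.colour s(w, w) ≠ L.colour s(a, a))
    (hhalf : 2 * (S.filter fun v => L.colour s(v, v) = L.colour s(w, w)).card ≤ S.card) :
    3 * S.card ≤ 2 * L.numValues (L.count S) + 8 := by
  set A := S.filter fun v => L.colour s(v, v) = L.colour s(w, w) with hA
  set B := S.filter fun v => ¬ L.colour s(v, v) = L.colour s(w, w) with hB
  have hAB : A.card + B.card = S.card := Finset.card_filter_add_card_filter_not _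
  have hBS : B ⊆ S := Finset.filter_subset _ _
  have haB : a ∈ B := Finset.mem_filter.mpr ⟨ha, hwa.symm⟩
  have hbB : b ∈ B := Finset.mem_filter.mpr ⟨hb, fun h => hwa (h.symm.trans hcab.symm)⟩
  have key : ∀ Y : Finset W, Y ⊆ B → 2 * ({a, b} ∪ Y).card ≤
      L.numValues (L.count ({a, b} ∪ Y)) + 4 := by
    intro Y
    induction Y using Finset.induction_on with
    | empty =>
      intro _
      rw [Finset.union_empty, Finset.card_pair hab]
      omega
    | insert v Y hvY ih =>
      intro hY
      have hvB := hY (Finset.mem_insert_self _ _)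
      have hYB := (Finset.subset_insert _ _).trans hY
      have ih := ih hYB
      rw [Finset.union_insert]
      set X := {a, b} ∪ Y with hX
      have hXB : X ⊆ B := Finset.union_subset
        (Finset.insert_subset haB (Finset.singleton_subset_iff.mpr hbB)) hYB
      by_cases hvX : v ∈ X
      · rwa [Finset.insert_eq_of_mem hvX]
      have haX : a ∈ X := by simp [hX]
      have hbX : b ∈ X := by simp [hX]
      have h2 : 2 ≤ X.card := by
        rw [← Finset.card_pair hab]
        exact Finset.card_le_card Finset.subset_union_left
      have h1 := h.count_insert (hBS hvB) (hXB.trans hBS) hvX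
      have hwX : w ∉ X := fun hm => (Finset.mem_filter.mp (hXB hm)).2 rfl
      -- `a` can go because `b` keeps its colour; `w` contributes a colour that is new to `X`.
      have hex : L.count (insert w (X.erase a)) = L.count X + 1 := by
        have hsub : insert w (X.erase a) ⊆ S :=
          Finset.insert_subset hw ((Finset.erase_subset _ _).trans (hXB.trans hBS))
        have hcard : (insert w (X.erase a)).card = X.card := by
          rw [Finset.card_insert_of_notMem fun hm => hwX (Finset.mem_of_mem_erase hm)]
          exact Finset.card_erase_add_one haX
        have hpal : L.loopPalette (insert w (X.erase a))
            = insert (L.colour s(w, w)) (L.loopPalette X) := by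
          ext c
          simp only [loopPalette, Finset.mem_erase, Finset.mem_image, Finset.mem_insert]
          constructor
          · rintro ⟨h0, x, rfl | ⟨-, hx⟩, rfl⟩
            · exact Or.inl rfl
            · exact Or.inr ⟨h0, x, hx, rfl⟩
          · rintro (rfl | ⟨h0, x, hx, rfl⟩)
            · exact ⟨hwb, w, Or.inl rfl, rfl⟩
            · by_cases hxa : x = a
              · subst hxa
                exact ⟨h0, b, Or.inr ⟨hab.symm, hbX⟩, hcab.symm⟩
              · exact ⟨h0, x, Or.inr ⟨hxa, hx⟩, rfl⟩
        have hnot : L.colour s(w, w) ∉ L.loopPalette X := by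
          intro hm
          obtain ⟨x, hx, hxc⟩ := Finset.mem_image.mp (Finset.mem_of_mem_erase hm)
          exact (Finset.mem_filter.mp (hXB hx)).2 hxc
        rw [h.count_eq hsub, h.count_eq (hXB.trans hBS), hcard, hpal,
          Finset.card_insert_of_notMem hnot]
        rfl
      have hN := numValues_add_card_le (L := L) (j := L.count X) (k := L.count (insert v X))
        (by omega) {L.count X + 1, L.count (insert v X)} (by
          intro x hx
          rw [Finset.mem_insert, Finset.mem_singleton] at hx
          rcases hx with rfl | rfl
          · exact ⟨by omega, by omega, _, hex⟩
          · exact ⟨by omega, le_rfl, _, rfl⟩)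
      rw [Finset.card_pair (by omega)] at hN
      rw [Finset.card_insert_of_notMem hvX]
      omega
  have key2 : ∀ Z : Finset W, Z ⊆ A →
      L.numValues (L.count B) + Z.card ≤ L.numValues (L.count (B ∪ Z)) := by
    intro Z
    induction Z using Finset.induction_on with
    | empty => intro _; simp
    | insert v Z hvZ ih =>
      intro hZ
      have hvA := Finset.mem_filter.mp (hZ (Finset.mem_insert_self _ _))
      have hZA := (Finset.subset_insert _ _).trans hZ
      have ih := ih hZA
      rw [Finset.union_insert, Finset.card_insert_of_notMem hvZ]
      have hvX : v ∉ B ∪ Z := by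
        rw [Finset.mem_union, not_or]
        exact ⟨fun hm => (Finset.mem_filter.mp hm).2 hvA.2, hvZ⟩
      have h1 := h.count_insert hvA.1
        (Finset.union_subset hBS (hZA.trans (Finset.filter_subset _ _))) hvX
      have h2 : 0 < (B ∪ Z).card := Finset.card_pos.mpr ⟨a, Finset.mem_union_left _ haB⟩
      have h3 := numValues_succ_le (L := L) (S := insert v (B ∪ Z)) (j := L.count (B ∪ Z))
        (by omega)
      omega
  have k1 := key B subset_rfl
  rw [Finset.union_eq_right.mpr
    (Finset.insert_subset haB (Finset.singleton_subset_iff.mpr hbB))] at k1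
  have k2 := key2 A subset_rfl
  rw [Finset.union_comm, Finset.filter_union_filter_not_eq] at k2
  omega

/-- The last case of the gain: all edges have colours of their own and all vertices have equally
many private colours. Unless the set is bad, no loop has a colour of its own, and two different
non-blank colours occur on loops. -/
lemma ProperEdges.le_numValues_of_const {S : Finset W} (h : L.ProperEdges S) {d : ℕ}
    (hd : ∀ v ∈ S, (L.priv S v).card = d) (h1 : ¬ L.RainbowLooped S)
    (h2 : ¬ L.RainbowUnlooped S) : 3 * S.card ≤ 2 * L.numValues (L.count S) + 8 := by
  have hclash : ∀ e ∈ L.clashes S, ∃ v ∈ S, e = s(v, v) := by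
    intro e he
    have heS := (Finset.mem_filter.mp he).1
    induction e using Sym2.ind with
    | _ u v =>
      rw [Finset.mk_mem_sym2_iff] at heS
      by_cases huv : u = v
      · exact ⟨u, heS.1, by rw [huv]⟩
      · exact absurd he (h u heS.1 v heS.2 huv)
  have hlow : ∀ v ∈ S, s(v, v) ∉ L.clashes S → S.card ≤ d := by
    intro v hv hvc
    have h3 := card_le_card_priv_add (L := L) S hv
    have h4 : L.clashesAt S v = ∅ := by
      rw [Finset.eq_empty_iff_forall_notMem]
      intro e he
      obtain ⟨he1, he2⟩ := Finset.mem_filter.mp he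
      obtain ⟨u, -, rfl⟩ := hclash e he1
      have : v = u := by simpa using he2
      exact hvc (this ▸ he1)
    rw [h4, hd v hv, Finset.card_empty] at h3
    exact h3
  have hup : ∀ v ∈ S, s(v, v) ∈ L.clashes S → d < S.card := by
    intro v hv hvc
    rw [← hd v hv, ← Finset.card_erase_add_one hv, Nat.lt_add_one_iff]
    refine (Finset.card_le_card ?_).trans
      (Finset.card_image_le (f := fun u => L.colour s(v, u)) (s := S.erase v))
    intro c hc
    have hc' := mem_priv.mp hc
    obtain ⟨h0, e, he, rfl⟩ := mem_palette.mp hc'.1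
    obtain ⟨u, hu, rfl⟩ := exists_eq_of_mem_sym2 he (hc'.2 e he rfl)
    by_cases huv : u = v
    · subst huv
      obtain ⟨e', he', hcol, hne⟩ := (Finset.mem_filter.mp hvc).2.resolve_left h0
      obtain ⟨x, hx, rfl⟩ := exists_eq_of_mem_sym2 he' (hc'.2 e' he' hcol)
      exact Finset.mem_image.mpr
        ⟨x, Finset.mem_erase.mpr ⟨fun hxu => hne (by rw [hxu]), hx⟩, hcol⟩
    · exact Finset.mem_image.mpr ⟨u, Finset.mem_erase.mpr ⟨huv, hu⟩, rfl⟩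
  have hall : ∀ v ∈ S, s(v, v) ∈ L.clashes S := by
    by_contra hcon
    push Not at hcon
    obtain ⟨v, hv, hvc⟩ := hcon
    have hdS := hlow v hv hvc
    have hnone : ∀ e ∈ S.sym2, e ∉ L.clashes S := by
      intro e _ he
      obtain ⟨u, hu, rfl⟩ := hclash e he
      have := hup u hu he
      omega
    exact h1 ⟨fun e he => ((LoopedColouring.notMem_clashes he).mp (hnone e he)).1,
      fun e he => ((LoopedColouring.notMem_clashes he).mp (hnone e he)).2⟩
  have hpr : ∀ e ∈ S.sym2, ¬ e.IsDiag → L.colour e ≠ L.blank ∧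
      ∀ e' ∈ S.sym2, L.colour e' = L.colour e → e' = e := fun e he hdiag =>
    (LoopedColouring.notMem_clashes he).mp (h.notMem_clashes he hdiag)
  have hloop : ∀ v ∈ S, ∀ e ∈ S.sym2, ¬ e.IsDiag → L.colour e ≠ L.colour s(v, v) := by
    intro v hv e he hdiag hc
    have := (hpr e he hdiag).2 _ (mem_sym2_of_mem hv hv) hc.symm
    exact hdiag (this ▸ Sym2.diag_isDiag v)
  have hpartner : ∀ v ∈ S, L.colour s(v, v) ≠ L.blank →
      ∃ u ∈ S, v ≠ u ∧ L.colour s(v, v) = L.colour s(u, u) := by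
    intro v hv hvb
    obtain ⟨e, he, hc, hne⟩ := (Finset.mem_filter.mp (hall v hv)).2.resolve_left hvb
    by_cases hdiag : e.IsDiag
    · induction e using Sym2.ind with
      | _ x y =>
        rw [Sym2.mk_isDiag_iff] at hdiag
        subst hdiag
        exact ⟨x, (Finset.mk_mem_sym2_iff.mp he).1, fun hvx => hne (by rw [hvx]), hc.symm⟩
    · exact absurd hc (hloop v hv e he hdiag)
  have htwo : ∀ c, (∀ e ∈ S.sym2, ¬ e.IsDiag → L.colour e ≠ c) →
      ∃ v ∈ S, L.colour s(v, v) ≠ L.blank ∧ L.colour s(v, v) ≠ c := by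
    intro c hc
    by_contra hcon
    push Not at hcon
    exact h2 ⟨fun e he hdiag => (hpr e he hdiag).1,
      fun e he hdiag e' he' _ => (hpr e he hdiag).2 e' he', c, hc,
      fun v hv => or_iff_not_imp_left.mpr (hcon v hv)⟩
  obtain ⟨a, ha, hab, -⟩ := htwo L.blank fun e he hdiag => (hpr e he hdiag).1
  obtain ⟨w, hw, hwb, hwa⟩ := htwo _ (hloop a ha)
  obtain ⟨a', ha', haa, hca⟩ := hpartner a ha hab
  obtain ⟨w', hw', hww, hcw⟩ := hpartner w hw hwb
  have hsum : (S.filter fun v => L.colour s(v, v) = L.colour s(w, w)).card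
      + (S.filter fun v => L.colour s(v, v) = L.colour s(a, a)).card ≤ S.card := by
    rw [← Finset.card_union_of_disjoint]
    · exact Finset.card_le_card
        (Finset.union_subset (Finset.filter_subset _ _) (Finset.filter_subset _ _))
    · rw [Finset.disjoint_filter]
      intro x _ h3 h4
      exact hwa (h3.symm.trans h4)
  rcases le_total (S.filter fun v => L.colour s(v, v) = L.colour s(w, w)).card
    (S.filter fun v => L.colour s(v, v) = L.colour s(a, a)).card with hle | hle
  · exact h.le_numValues ha ha' hw haa hca hwb hwa (by omega)
  · exact h.le_numValues hw hw' ha hww hcw hab hwa.symm (by omega)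

end PairedValues

/-! ### Almost rainbow colourings that are not bad -/

/-- The number of edges and loops that are superfluous for displaying the colours is monotone. -/
lemma card_sym2_add_count_le {S T : Finset W} (h : S ⊆ T) :
    S.sym2.card + L.count T ≤ T.sym2.card + L.count S := by
  have hs := Finset.sym2_mono h
  have h1 : L.palette T ⊆ L.palette S ∪ (T.sym2 \ S.sym2).image L.colour := by
    intro c hc
    obtain ⟨h0, e, he, rfl⟩ := mem_palette.mp hc
    rw [Finset.mem_union]
    by_cases heS : e ∈ S.sym2
    · exact Or.inl (mem_palette.mpr ⟨h0, e, heS, rfl⟩)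
    · exact Or.inr (Finset.mem_image_of_mem _ (Finset.mem_sdiff.mpr ⟨he, heS⟩))
  have h2 := (Finset.card_le_card h1).trans (Finset.card_union_le _ _)
  have h3 : ((T.sym2 \ S.sym2).image L.colour).card ≤ (T.sym2 \ S.sym2).card :=
    Finset.card_image_le
  have h4 := Finset.card_sdiff_add_card_eq_card hs
  unfold count
  omega

section Gain

variable [Fintype W]

lemma numValues_add_four_le {p₀ p₁ p₂ p₃ q : ℕ} (h₁ : p₁ < p₀) (h₂ : p₂ < p₁) (h₃ : p₃ < p₂)
    (hq₀ : q < p₀) (hq₁ : q ≠ p₁) (hq₂ : q ≠ p₂) (hq₃ : p₃ < q) (e₀ : ∃ S, L.count S = p₀)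
    (e₁ : ∃ S, L.count S = p₁) (e₂ : ∃ S, L.count S = p₂) (e : ∃ S, L.count S = q) :
    L.numValues p₃ + 4 ≤ L.numValues p₀ := by
  have h := numValues_add_card_le (L := L) (j := p₃) (k := p₀) (by omega) {p₀, p₁, p₂, q} (by
    intro a ha
    simp only [Finset.mem_insert, Finset.mem_singleton] at ha
    rcases ha with rfl | rfl | rfl | rfl
    · exact ⟨by omega, by omega, e₀⟩
    · exact ⟨by omega, by omega, e₁⟩
    · exact ⟨by omega, by omega, e₂⟩
    · exact ⟨by omega, by omega, e⟩)
  have hc : ({p₀, p₁, p₂, q} : Finset ℕ).card = 4 := by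
    rw [Finset.card_insert_of_notMem, Finset.card_insert_of_notMem, Finset.card_pair hq₂.symm]
    · simp only [Finset.mem_insert, Finset.mem_singleton]; omega
    · simp only [Finset.mem_insert, Finset.mem_singleton]; omega
  rwa [hc] at h

/-- Removing three vertices from an almost rainbow set that is not bad costs at least four values,
unless the set has many values for a direct reason. -/
lemma Reduced.exists_gain {S T : Finset W} (hred : L.Reduced S) (hTS : T ⊆ S)
    (hT : T.card ≤ 8) (hT1 : ¬ L.RainbowLooped T) (hT2 : ¬ L.RainbowUnlooped T)
    (hS : 200 ≤ S.card) (hnear : ∀ X ⊆ S, S.card ≤ X.card + 2 → L.NearRainbow X) :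
    3 * S.card ≤ 2 * L.numValues (L.count S) + 8 ∨
      ∃ S' ⊆ S, T ⊆ S' ∧ L.Reduced S' ∧ S'.card + 3 = S.card ∧
        L.numValues (L.count S') + 4 ≤ L.numValues (L.count S) := by
  have hn0 := hnear S subset_rfl (by omega)
  obtain ⟨v₁, hv₁, ht₁, hr₁, hred₁⟩ := hn0.exists_erase hred (by omega) hT
  have hc₁ := Finset.card_erase_add_one hv₁
  have hs₁ : S.erase v₁ ⊆ S := Finset.erase_subset _ _
  obtain ⟨v₂, hv₂, ht₂, hr₂, hred₂⟩ :=
    (hnear _ hs₁ (by omega)).exists_erase hred₁ (by omega) hT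
  have hc₂ := Finset.card_erase_add_one hv₂
  have hs₂ : (S.erase v₁).erase v₂ ⊆ S := (Finset.erase_subset _ _).trans hs₁
  obtain ⟨v₃, hv₃, ht₃, hr₃, hred₃⟩ :=
    (hnear _ hs₂ (by omega)).exists_erase hred₂ (by omega) hT
  have hc₃ := Finset.card_erase_add_one hv₃
  have hp₁ := count_erase_add_card_priv (L := L) S v₁
  have hp₂ := count_erase_add_card_priv (L := L) (S.erase v₁) v₂
  have hp₃ := count_erase_add_card_priv (L := L) ((S.erase v₁).erase v₂) v₃
  have hfin : ∀ X : Finset W, L.count X < L.count S → L.count X ≠ L.count (S.erase v₁) →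
      L.count X ≠ L.count ((S.erase v₁).erase v₂) →
      L.count (((S.erase v₁).erase v₂).erase v₃) < L.count X →
      ∃ S' ⊆ S, T ⊆ S' ∧ L.Reduced S' ∧ S'.card + 3 = S.card ∧
        L.numValues (L.count S') + 4 ≤ L.numValues (L.count S) := by
    intro X h0 h1 h2 h3
    refine ⟨((S.erase v₁).erase v₂).erase v₃, (Finset.erase_subset _ _).trans hs₂, ?_,
      hred₃, by omega, ?_⟩
    · exact Finset.subset_erase.mpr
        ⟨Finset.subset_erase.mpr ⟨Finset.subset_erase.mpr ⟨hTS, ht₁⟩, ht₂⟩, ht₃⟩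
    · exact numValues_add_four_le (by omega) (by omega) (by omega) h0 h1 h2 h3 ⟨_, rfl⟩ ⟨_, rfl⟩
        ⟨_, rfl⟩ ⟨_, rfl⟩
  by_cases hA : ∃ u ∈ S, (L.priv S u).card ≠ (L.priv S v₁).card
  · obtain ⟨u, hu, hne⟩ := hA
    have h1 := count_erase_add_card_priv (L := L) S u
    have h2 := card_priv_le (L := L) S u
    have h3 := hred.one_le hu
    exact Or.inr (hfin (S.erase u) (by omega) (by omega) (by omega) (by omega))
  push Not at hA
  by_cases hB : ∃ u ∈ S, ∃ w ∈ S, u ≠ w ∧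
      L.count ((S.erase u).erase w) ≠ L.count ((S.erase v₁).erase v₂)
  · obtain ⟨u, hu, w, hw, huw, hne⟩ := hB
    have h1 := count_erase_add_card_priv (L := L) S u
    have h2 := count_erase_add_card_priv (L := L) (S.erase u) w
    have h3 := card_priv_le_erase_add_one (L := L) S huw.symm
    have h4 := card_priv_le (L := L) (S.erase u) w
    have h5 := Finset.card_erase_add_one hu
    have h6 := hA u hu
    have h7 := hA w hw
    have h8 := card_priv_le (L := L) S u
    exact Or.inr (hfin ((S.erase u).erase w) (by omega) (by omega) hne (by omega))
  push Not at hB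
  have hproper : L.ProperEdges S := fun u hu w hw huw =>
    hn0.notMem_clashes_of_const (by omega) hA (fun u hu w hw huw => hB u hu w hw huw) hu hw huw
  exact Or.inl (hproper.le_numValues_of_const hA (fun h => hT1 (h.mono hTS))
    (fun h => hT2 (h.mono hTS)))

lemma two_mul_card_sym2 (S : Finset W) : 2 * S.sym2.card = S.card * (S.card + 1) := by
  rw [Finset.card_sym2, Nat.choose_two_right, Nat.add_sub_cancel, Nat.mul_div_cancel', mul_comm]
  exact (Nat.even_mul_pred_self (S.card + 1)).two_dvd

/-- An almost rainbow colouring of a complete graph on `n` vertices which is not bad has at least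
`21 (n + 1) / 20` values. -/
lemma Reduced.le_numValues_of_near {S : Finset W} (hred : L.Reduced S)
    (h1 : ¬ L.RainbowLooped S) (h2 : ¬ L.RainbowUnlooped S) (hS : 1000 ≤ S.card)
    (hnear : 400 * S.sym2.card ≤ 400 * L.count S + S.card ^ 2) :
    21 * (S.card + 1) ≤ 20 * L.numValues (L.count S) := by
  obtain ⟨T₁, hs₁, hc₁, hT₁⟩ := exists_small_not_rainbowLooped h1
  obtain ⟨T₂, hs₂, hc₂, hT₂⟩ := exists_small_not_rainbowUnlooped h2
  have hcT := Finset.card_union_le T₁ T₂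
  have hT₁' : ¬ L.RainbowLooped (T₁ ∪ T₂) := fun h => hT₁ (h.mono Finset.subset_union_left)
  have hT₂' : ¬ L.RainbowUnlooped (T₁ ∪ T₂) := fun h => hT₂ (h.mono Finset.subset_union_right)
  have hTS : T₁ ∪ T₂ ⊆ S := Finset.union_subset hs₁ hs₂
  have key : ∀ j : ℕ, 12 * j ≤ S.card →
      3 * S.card ≤ 2 * L.numValues (L.count S) + 8 + j ∨
        ∃ R ⊆ S, T₁ ∪ T₂ ⊆ R ∧ L.Reduced R ∧ R.card + 3 * j = S.card ∧
          L.numValues (L.count R) + 4 * j ≤ L.numValues (L.count S) := by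
    intro j
    induction j with
    | zero => exact fun _ => Or.inr ⟨S, subset_rfl, hTS, hred, by omega, by omega⟩
    | succ j ih =>
      intro hj
      rcases ih (by omega) with h | ⟨R, hRS, hTR, hredR, hc, hN⟩
      · exact Or.inl (by omega)
      have hnearR : ∀ X ⊆ R, R.card ≤ X.card + 2 → L.NearRainbow X := by
        intro X hX hXc
        have hD := card_sym2_add_count_le (L := L) (hX.trans hRS)
        have h3 : 3 * S.card ≤ 4 * X.card := by omega
        unfold NearRainbow
        nlinarith
      rcases hredR.exists_gain hTR (by omega) hT₁' hT₂' (by omega) hnearR with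
        h | ⟨R', hR', hT', hred', hc', hN'⟩
      · exact Or.inl (by omega)
      · exact Or.inr ⟨R', hR'.trans hRS, hT', hred', by omega, by omega⟩
  rcases key (S.card / 12) (by omega) with h | ⟨R, hRS, -, -, hc, hN⟩
  · omega
  have hD := card_sym2_add_count_le (L := L) hRS
  have hA := two_mul_count_add_le_sq (L := L) R
  have h3 := two_mul_card_sym2 R
  -- `0.746² < 9/16 - 1/200`
  have h4 : 746 * S.card ≤ 1000 * L.numValues (L.count R) := by
    by_contra hcon
    push Not at hcon
    have h5 : 3 * S.card ≤ 4 * R.card := by omega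
    nlinarith
  omega

end Gain

end LoopedColouring

/-! ### From special colourings to looped colourings -/

namespace SpecialColouring

variable {V C : Type*} (Δ : SpecialColouring V C)

open Classical in
/-- The edge of the complete graph on `V` that an edge or loop on the non-special vertices stands
for: the loop at `v` stands for the edge from `v` to the special vertex. -/
noncomputable def unloop : Sym2 {v : V // v ≠ Δ.special} → Sym2 V :=
  Sym2.lift ⟨fun u v => if u = v then s(Δ.special, (u : V)) else s((u : V), (v : V)), by
    intro u v
    by_cases h : u = v
    · simp [h]
    · simp [h, Ne.symm h, Sym2.eq_swap]⟩

lemma unloop_diag (u : {v : V // v ≠ Δ.special}) : Δ.unloop s(u, u) = s(Δ.special, (u : V)) := by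
  simp [unloop]

lemma unloop_of_ne {u v : {v : V // v ≠ Δ.special}} (h : u ≠ v) :
    Δ.unloop s(u, v) = s((u : V), (v : V)) := by
  simp [unloop, h]

lemma coe_mem_unloop {w : {v : V // v ≠ Δ.special}} {e : Sym2 {v : V // v ≠ Δ.special}} :
    (w : V) ∈ Δ.unloop e ↔ w ∈ e := by
  induction e using Sym2.ind with
  | _ u v =>
    by_cases h : u = v
    · subst h
      simp [unloop_diag, w.2, Subtype.ext_iff]
    · simp [unloop_of_ne Δ h, Subtype.ext_iff]

lemma special_mem_unloop {e : Sym2 {v : V // v ≠ Δ.special}} :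
    Δ.special ∈ Δ.unloop e ↔ e.IsDiag := by
  induction e using Sym2.ind with
  | _ u v =>
    by_cases h : u = v
    · subst h
      simp [unloop_diag]
    · simp [unloop_of_ne Δ h, h, u.2.symm, v.2.symm]

lemma unloop_mem_edgeSet (e : Sym2 {v : V // v ≠ Δ.special}) :
    Δ.unloop e ∈ (⊤ : SimpleGraph V).edgeSet := by
  induction e using Sym2.ind with
  | _ u v =>
    by_cases h : u = v
    · subst h
      simpa [unloop_diag] using u.2.symm
    · simpa [unloop_of_ne Δ h, Subtype.ext_iff] using h

lemma exists_unloop_eq {e : Sym2 V} (he : e ∈ (⊤ : SimpleGraph V).edgeSet) :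
    ∃ e', Δ.unloop e' = e := by
  induction e using Sym2.ind with
  | _ a b =>
    have hab : a ≠ b := by simpa using he
    by_cases ha : a = Δ.special
    · have hb : b ≠ Δ.special := fun h => hab (ha.trans h.symm)
      exact ⟨s(⟨b, hb⟩, ⟨b, hb⟩), by rw [unloop_diag, ha]⟩
    by_cases hb : b = Δ.special
    · exact ⟨s(⟨a, ha⟩, ⟨a, ha⟩), by rw [unloop_diag, hb, Sym2.eq_swap]⟩
    · exact ⟨s(⟨a, ha⟩, ⟨b, hb⟩), unloop_of_ne Δ (by simpa using hab)⟩

/-- The looped colouring on the non-special vertices that corresponds to a special colouring. The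
colour of the special vertex becomes `blank`. -/
noncomputable def toLooped : LoopedColouring {v : V // v ≠ Δ.special} C where
  colour e := Δ.edge ⟨Δ.unloop e, Δ.unloop_mem_edgeSet e⟩
  blank := Δ.specialColour

/-- The edge or loop that stands for an edge of the complete graph on `V`. -/
lemma exists_toLooped_eq (e : (⊤ : SimpleGraph V).edgeSet) :
    ∃ e', Δ.unloop e' = e ∧ Δ.toLooped.colour e' = Δ.edge e := by
  obtain ⟨e', he'⟩ := Δ.exists_unloop_eq e.2
  exact ⟨e', he', congrArg Δ.edge (Subtype.ext he')⟩

section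

variable [DecidableEq {v : V // v ≠ Δ.special}] [DecidableEq C]

lemma insert_edgeColours (S : Finset {v : V // v ≠ Δ.special}) :
    insert Δ.specialColour (Δ.edgeColours (insert Δ.special (Subtype.val '' (S : Set {v : V // v ≠ Δ.special}))))
      = (insert Δ.specialColour (Δ.toLooped.palette S) : Finset C) := by
  ext c
  rw [Finset.coe_insert, Set.mem_insert_iff, Set.mem_insert_iff, Finset.mem_coe,
    LoopedColouring.mem_palette]
  by_cases hc : c = Δ.specialColour
  · simp [hc]
  have hc' : c ≠ Δ.toLooped.blank := hc
  simp only [hc, hc', false_or, ne_eq, not_false_eq_true, true_and]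
  constructor
  · rintro ⟨e, he, rfl⟩
    obtain ⟨e', he', hcol⟩ := Δ.exists_toLooped_eq e
    refine ⟨e', Finset.mem_sym2_iff.mpr fun a ha => ?_, hcol⟩
    have := he a (he' ▸ Δ.coe_mem_unloop.mpr ha)
    simpa [a.2] using this
  · rintro ⟨e, he, rfl⟩
    refine ⟨_, fun v hv => ?_, rfl⟩
    by_cases hvs : v = Δ.special
    · exact Or.inl hvs
    · exact Or.inr ⟨⟨v, hvs⟩, Finset.mem_sym2_iff.mp he _
        (Δ.coe_mem_unloop (w := ⟨v, hvs⟩).mp hv), rfl⟩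

lemma gamma_insert (S : Finset {v : V // v ≠ Δ.special}) :
    Δ.gamma (insert Δ.special (Subtype.val '' (S : Set {v : V // v ≠ Δ.special}))) = Δ.toLooped.count S + 1 := by
  rw [gamma, insert_edgeColours, Set.ncard_coe_finset, Finset.card_insert_of_notMem]
  · rfl
  · exact fun h => (LoopedColouring.mem_palette.mp h).1 rfl

variable [Fintype {v : V // v ≠ Δ.special}]

lemma gamma_univ : Δ.gamma Set.univ = Δ.toLooped.count Finset.univ + 1 := by
  rw [← gamma_insert]
  congr 1
  ext v
  by_cases hv : v = Δ.special <;> simp [hv]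

lemma numValues_le_ncard_colourCounts [Finite V] (k : ℕ) :
    Δ.toLooped.numValues k ≤ Δ.colourCounts.ncard := by
  have hfin : Δ.colourCounts.Finite :=
    (Set.finite_range Δ.gamma).subset fun k hk => ⟨hk.choose, hk.choose_spec.2⟩
  rw [LoopedColouring.numValues, ← Set.ncard_coe_finset]
  refine Set.ncard_le_ncard_of_injOn (· + 1) ?_ (fun a _ b _ h => by simpa using h) hfin
  intro a ha
  obtain ⟨S, -, rfl⟩ := Finset.mem_image.mp (Finset.mem_filter.mp ha).1
  exact ⟨_, Set.mem_insert _ _, Δ.gamma_insert S⟩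

lemma reduced_toLooped (h : ∀ v : V, v ≠ Δ.special → 1 ≤ Δ.rho v) :
    Δ.toLooped.Reduced Finset.univ := by
  intro w _
  have h1 := h w w.2
  obtain ⟨c, ⟨e, -, hec⟩, hcs, hcw⟩ := Set.nonempty_of_ncard_ne_zero (Nat.one_le_iff_ne_zero.mp h1)
  obtain ⟨e', he', hcol⟩ := Δ.exists_toLooped_eq e
  refine ⟨c, LoopedColouring.mem_priv.mpr
    ⟨LoopedColouring.mem_palette.mpr ⟨hcs, e', ?_, hcol.trans hec⟩, fun x _ hx => ?_⟩⟩
  · exact Finset.mem_sym2_iff.mpr fun _ _ => Finset.mem_univ _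
  · exact Δ.coe_mem_unloop.mp (hcw _ hx)

lemma isBadI_of_rainbowLooped (h : Δ.toLooped.RainbowLooped Finset.univ) : Δ.IsBadI := by
  have hmem : ∀ e : Sym2 {v : V // v ≠ Δ.special}, e ∈ Finset.univ.sym2 := fun e =>
    Finset.mem_sym2_iff.mpr fun _ _ => Finset.mem_univ _
  constructor
  · intro e₁ _ e₂ _ hc
    obtain ⟨e₁', h₁, hc₁⟩ := Δ.exists_toLooped_eq e₁
    obtain ⟨e₂', h₂, hc₂⟩ := Δ.exists_toLooped_eq e₂
    have := h.2 e₂' (hmem _) e₁' (hmem _) (hc₁.trans (hc.trans hc₂.symm))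
    exact Subtype.ext (by rw [← h₁, ← h₂, this])
  · rintro ⟨e, -, hc⟩
    obtain ⟨e', -, hc'⟩ := Δ.exists_toLooped_eq e
    exact h.1 e' (hmem _) (hc'.trans hc)

lemma isBadII_of_rainbowUnlooped (h : Δ.toLooped.RainbowUnlooped Finset.univ) : Δ.IsBadII := by
  have hmem : ∀ e : Sym2 {v : V // v ≠ Δ.special}, e ∈ Finset.univ.sym2 := fun e =>
    Finset.mem_sym2_iff.mpr fun _ _ => Finset.mem_univ _
  obtain ⟨h1, h2, c, h3, h4⟩ := h
  have hlift : ∀ e ∈ edgesIn ({Δ.special}ᶜ : Set V), ∃ e', Δ.unloop e' = e ∧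
      Δ.toLooped.colour e' = Δ.edge e ∧ ¬ e'.IsDiag := by
    intro e he
    obtain ⟨e', he', hc⟩ := Δ.exists_toLooped_eq e
    refine ⟨e', he', hc, fun hd => ?_⟩
    exact he Δ.special (he' ▸ Δ.special_mem_unloop.mpr hd) rfl
  refine ⟨?_, ?_, c, ?_, ?_⟩
  · intro e₁ he₁ e₂ he₂ hc
    obtain ⟨e₁', hu₁, hc₁, hd₁⟩ := hlift e₁ he₁
    obtain ⟨e₂', hu₂, hc₂, hd₂⟩ := hlift e₂ he₂
    have := h2 e₂' (hmem _) hd₂ e₁' (hmem _) hd₁ (hc₁.trans (hc.trans hc₂.symm))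
    exact Subtype.ext (by rw [← hu₁, ← hu₂, this])
  · rintro ⟨e, he, hc⟩
    obtain ⟨e', -, hc', hd⟩ := hlift e he
    exact h1 e' (hmem _) hd (hc'.trans hc)
  · rintro ⟨e, he, hc⟩
    obtain ⟨e', -, hc', hd⟩ := hlift e he
    exact h3 e' (hmem _) hd (hc'.trans hc)
  · intro e he
    obtain ⟨e', he', hc'⟩ := Δ.exists_toLooped_eq e
    have hd := Δ.special_mem_unloop.mp (he' ▸ he)
    rw [← hc']
    induction e' using Sym2.ind with
    | _ u v =>
      rw [Sym2.mk_isDiag_iff] at hd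
      subst hd
      exact h4 u (Finset.mem_univ _)

end

end SpecialColouring

/-! ### Few and many colours -/

namespace LoopedColouring

variable {W C : Type*} [DecidableEq W] [DecidableEq C] [Fintype W] {L : LoopedColouring W C}

/-- For a bounded number of colours the inequality `2f + N ≤ N²` suffices. -/
lemma le_numValues_of_count_small {S : Finset W} (h2 : 2 ≤ L.count S)
    (hs : L.count S + 1 ≤ 10 ^ 17) :
    (1 + 1 / 10 ^ 19) * Real.sqrt (2 * (L.count S + 1)) ≤ L.numValues (L.count S) := by
  have hA := two_mul_count_add_le_sq (L := L) S
  have h3 : 3 ≤ L.numValues (L.count S) := by nlinarith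
  have hsr : (L.count S : ℝ) + 1 ≤ 10 ^ 17 := by exact_mod_cast hs
  have hN : 2 * ((L.count S : ℝ) + 1) + 1 ≤ (L.numValues (L.count S) : ℝ) ^ 2 := by
    have : 2 * (L.count S + 1) + 1 ≤ L.numValues (L.count S) ^ 2 := by omega
    exact_mod_cast this
  refine (sq_le_sq₀ (by positivity) (Nat.cast_nonneg _)).mp ?_
  rw [mul_pow, Real.sq_sqrt (by positivity)]
  have h4 : ((1 : ℝ) + 1 / 10 ^ 19) ^ 2 ≤ 1 + 3 / 10 ^ 19 := by norm_num
  have h5 : (0 : ℝ) ≤ 2 * ((L.count S : ℝ) + 1) := by positivity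
  nlinarith [mul_le_mul_of_nonneg_right h4 h5]

/-- For many colours, either the colouring is almost rainbow, or there are noticeably more vertices
than an almost rainbow colouring would need. -/
lemma Reduced.le_numValues_of_count_large {S : Finset W} (hred : L.Reduced S)
    (h1 : ¬ L.RainbowLooped S) (h2 : ¬ L.RainbowUnlooped S) (hbig : 10 ^ 17 ≤ L.count S + 1) :
    (1 + 1 / 10 ^ 19) * Real.sqrt (2 * (L.count S + 1)) ≤ L.numValues (L.count S) := by
  have hc := count_le_card_sym2 (L := L) S
  have hs := two_mul_card_sym2 S
  have hn : 10 ^ 8 ≤ S.card := by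
    by_contra hcon
    push Not at hcon
    nlinarith
  by_cases hnear : 400 * S.sym2.card ≤ 400 * L.count S + S.card ^ 2
  · have h3 := hred.le_numValues_of_near h1 h2 (by omega) hnear
    have h4 : Real.sqrt (2 * (L.count S + 1)) ≤ S.card + 1 := by
      rw [Real.sqrt_le_left (by positivity)]
      have : 2 * (L.count S + 1) ≤ (S.card + 1) ^ 2 := by nlinarith
      exact_mod_cast this
    have h5 : 21 * ((S.card : ℝ) + 1) ≤ 20 * L.numValues (L.count S) := by exact_mod_cast h3
    have h6 : (0 : ℝ) ≤ S.card := Nat.cast_nonneg _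
    have h7 : (1 + 1 / 10 ^ 19) * Real.sqrt (2 * (L.count S + 1))
        ≤ (1 + 1 / 10 ^ 19) * ((S.card : ℝ) + 1) := mul_le_mul_of_nonneg_left h4 (by norm_num)
    linarith
  · push Not at hnear
    have hM : (10 : ℝ) ^ 17 ≤ L.count S + 1 := by exact_mod_cast hbig
    set r := Real.sqrt (2 * L.count S) with hr
    have hr2 : r ^ 2 = 2 * L.count S := Real.sq_sqrt (by positivity)
    have hr0 : 10 ^ 8 ≤ r := Real.le_sqrt_of_sq_le (by linarith)
    have hcard : (1 + 1 / 1000) * r ≤ S.card := by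
      refine (sq_le_sq₀ (by positivity) (Nat.cast_nonneg _)).mp ?_
      rw [mul_pow, hr2]
      have h3 : 400 * (2 * L.count S) + 2 * S.card ^ 2 < 400 * (S.card * (S.card + 1)) := by
        rw [← hs]; omega
      have h4 : 400 * (2 * (L.count S : ℝ)) + 2 * (S.card : ℝ) ^ 2
          < 400 * (S.card * ((S.card : ℝ) + 1)) := by exact_mod_cast h3
      have h5 : (10 : ℝ) ^ 8 ≤ S.card := by exact_mod_cast hn
      clear hbig hn hc hs h3 hnear
      have h6 : (10 : ℝ) ^ 8 * S.card ≤ S.card * S.card :=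
        mul_le_mul_of_nonneg_right h5 (Nat.cast_nonneg _)
      linarith
    have h3 := hred.le_numValues_of_card_ge (by linarith) hcard
    have h4 : Real.sqrt (2 * (L.count S + 1)) ≤ (1 + 1 / 10 ^ 10) * r := by
      rw [Real.sqrt_le_left (by positivity), mul_pow, hr2]
      clear hbig hn hc hs hnear
      linarith
    have h5 : (1 + 1 / 10 ^ 19) * Real.sqrt (2 * (L.count S + 1))
        ≤ (1 + 1 / 10 ^ 19) * ((1 + 1 / 10 ^ 10) * r) := mul_le_mul_of_nonneg_left h4 (by norm_num)
    refine h5.trans (le_trans ?_ h3)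
    rw [← mul_assoc]
    exact mul_le_mul_of_nonneg_right (by norm_num) (by linarith)

end LoopedColouring

theorem theorem3 :
    ∃ α' : ℝ, 0 < α' ∧
      ∀ (V : Type) [Finite V] (C : Type) (Δ : SpecialColouring V C) (m : ℕ),
        3 ≤ m → Δ.IsColouringWith m →
        (∀ v : V, v ≠ Δ.special → 1 ≤ Δ.rho v) →
        Δ.IsBad ∨ (1 + α') * Real.sqrt (2 * (m : ℝ)) ≤ (Δ.colourCounts.ncard : ℝ) := by
  -- Up to `10 ^ 17` colours `N² ≥ 2 m + 1` gives a factor `1 + 1 / 10 ^ 19`; beyond that the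
  -- asymptotic gain, which is more than `1 / 10 ^ 8`, exceeds all rounding errors.
  refine ⟨1 / 10 ^ 19, by norm_num, ?_⟩
  intro V _ C Δ m hm hΔ hρ
  classical
  have := Fintype.ofFinite {v : V // v ≠ Δ.special}
  rw [or_iff_not_imp_left]
  intro hbad
  have hred := Δ.reduced_toLooped hρ
  have hm' : Δ.toLooped.count Finset.univ + 1 = m := by rw [← Δ.gamma_univ]; exact hΔ
  have hN : (Δ.toLooped.numValues (Δ.toLooped.count Finset.univ) : ℝ) ≤ Δ.colourCounts.ncard := by
    exact_mod_cast Δ.numValues_le_ncard_colourCounts _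
  refine le_trans ?_ hN
  rw [← hm', Nat.cast_add, Nat.cast_one]
  rcases le_total (Δ.toLooped.count Finset.univ + 1) (10 ^ 17) with h | h
  · exact LoopedColouring.le_numValues_of_count_small (by omega) h
  · exact hred.le_numValues_of_count_large
      (fun h => hbad (Or.inl (Δ.isBadI_of_rainbowLooped h)))
      (fun h => hbad (Or.inr (Δ.isBadII_of_rainbowUnlooped h))) h
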